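/- Let $\mathcal V$ be a real Banach space, let $\|\cdot\|_{\mathcal V\otimes\mathcal V}$ be a norm on the algebraic tensor product of $\mathcal V$ with itself such that $\|v\otimes w\|_{\mathcal V\otimes\mathcal V}\le\|v\|\,\|w\|$ for all $v,w\in\mathcal V$, and let $\mathcal V\otimes\mathcal V$ denote the completion. Put $[v,w]:=v\otimes w-w\otimes v$ and let $[\mathcal V,\mathcal V]\subseteq\mathcal V\otimes\mathcal V$ be the closed linear span of all $[v,w]$. Let $T>0$. A partition $D$ of an interval $[a,b]$ is a finite set of points $a=t_0<\dots<t_n=b$, with mesh $|D|=\max_j(t_{j+1}-t_j)$. For a function $\alpha$ on $\triangle=\{(s,t):0\le s\le t\le T\}$ with values in a Banach space and $p>0$ put $$\|\alpha\|_{p\text{-var}}=\Big(\sup_D\sum_j\|\alpha(t_j,t_{j+1})\|^p\Big)^{1/p},\qquad \omega_p(\alpha,\delta)=\Big(\sup_{|D|\le\delta}\sum_j\|\alpha(t_j,t_{j+1})\|^p\Big)^{1/p},$$ the suprema being over partitions $D$ of $[0,T]$; for a path $\gamma$ on $[0,T]$ use $\alpha(s,t)=\gamma(t)-\gamma(s)$.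 A continuous path, or a continuous function on $\triangle$ that vanishes on the diagonal, is of vanishing $p$-variation if $\omega_p(\cdot,\delta)\to0$ as $\delta\to0^+$. A Riemann–Stieltjes integral is the limit, as the mesh tends to $0$, of Riemann sums with arbitrary representative points $\xi_j\in[t_j,t_{j+1}]$. For a continuous path $\gamma$ of bounded variation let $$A(\gamma)(s,t)=\tfrac12\iint_{s<u_1<u_2<t}[d\gamma(u_1),d\gamma(u_2)]=\tfrac12\int_s^t[\gamma(u)-\gamma(s),d\gamma(u)]\in[\mathcal V,\mathcal V].$$ For $\gamma:[0,T]\to\mathcal V$ continuous and $\alpha:\triangle\to[\mathcal V,\mathcal V]$ continuous with $\alpha(t,t)=0$, the pair $(\gamma,\alpha)$ is a geometric $2$-rough path if there are continuous paths $\gamma_n$ of bounded variation with $\big(\|\gamma-\gamma_n\|_{2\text{-var}}^2+\|\alpha-A(\gamma_n)\|_{1\text{-var}}\big)^{1/2}\to0$. Let $\mathcal G_2(\mathcal V)$ be the set of paths $\gamma$ of vanishing $2$-variation for which there is an $\alpha$ of vanishing $1$-variation such that $(\gamma,\alpha)$ is a geometric $2$-rough path. For a partition $D$ of $[0,T]$,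 let $\gamma^D$ be the piecewise linear path that agrees with $\gamma$ at the points of $D$ and is linear in between. **Theorem.** Let $\gamma:[0,T]\to\mathcal V$ be a continuous path of vanishing $2$-variation. Then $\gamma\in\mathcal G_2(\mathcal V)$ if and only if $A(\gamma^D)$ converges in $1$-variation as $|D|\to0$, i.e. there is a continuous $\alpha:\triangle\to[\mathcal V,\mathcal V]$ with $\alpha(t,t)=0$ for all $t$ and $\|A(\gamma^D)-\alpha\|_{1\text{-var}}\to0$ as $|D|\to0$. Moreover, whenever $(\gamma,\alpha)$ is a geometric $2$-rough path, $A(\gamma^D)\to\alpha$ in $1$-variation as $|D|\to0$, and for all $0\le s\le t\le T$ the Riemann–Stieltjes integral $\int_s^t[\gamma(u)-\gamma(s),d\gamma(u)]$ exists and $$\alpha(s,t)=\tfrac12\int_s^t[\gamma(u)-\gamma(s),d\gamma(u)].$$ -/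

import Mathlib

open Filter Topology
open scoped ENNReal TensorProduct

noncomputable section

namespace RoughArea

/-! ### Partitions -/

/-- A finite partition `a = t₀ < t₁ < ⋯ < tₙ = b` of `[a, b]`. Only the values `pt 0, …, pt n`
matter. -/
structure Partition (a b : ℝ) where
  n : ℕ
  pt : ℕ → ℝ
  pt_zero : pt 0 = a
  pt_last : pt n = b
  lt_succ : ∀ i < n, pt i < pt (i + 1)

/-- The mesh `|D| = max_j (t_{j+1} - t_j)`. -/
def Partition.mesh {a b : ℝ} (D : Partition a b) : ℝ :=
  ⨆ i : Fin D.n, (D.pt (i + 1) - D.pt i)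

/-- A partition with representative points `ξ_j ∈ [t_j, t_{j+1}]`. -/
structure TaggedPartition (a b : ℝ) extends Partition a b where
  tag : ℕ → ℝ
  tag_mem : ∀ i < n, tag i ∈ Set.Icc (pt i) (pt (i + 1))

/-- The filter "`|D| → 0`" on partitions of `[a, b]`. -/
def meshToZero (a b : ℝ) : Filter (Partition a b) :=
  comap Partition.mesh (𝓝 0)

/-- The filter "`|D| → 0`" on tagged partitions of `[a, b]`. -/
def taggedMeshToZero (a b : ℝ) : Filter (TaggedPartition a b) :=
  comap (fun D => D.toPartition.mesh) (𝓝 0)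

/-- The piecewise linear path `γ^D` which agrees with `γ` on the points of `D`, written as
`γ(t₀) + ∑ⱼ λⱼ(t) (γ(t_{j+1}) - γ(t_j))` where `λⱼ` is `(t - t_j) / (t_{j+1} - t_j)` truncated to
`[0, 1]`; see `Partition.interp_eq`. -/
def Partition.interp {V : Type*} [NormedAddCommGroup V] [NormedSpace ℝ V] {a b : ℝ}
    (D : Partition a b) (γ : ℝ → V) (t : ℝ) : V :=
  γ (D.pt 0) + ∑ j ∈ Finset.range D.n,
    (max 0 (min 1 ((t - D.pt j) / (D.pt (j + 1) - D.pt j)))) • (γ (D.pt (j + 1)) - γ (D.pt j))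

theorem Partition.pt_le {a b : ℝ} (D : Partition a b) {i j : ℕ} (hij : i ≤ j) (hj : j ≤ D.n) :
    D.pt i ≤ D.pt j := by
  induction j, hij using Nat.le_induction with
  | base => exact le_rfl
  | succ k hk ih => exact (ih (by omega)).trans (D.lt_succ k (by omega)).le

/-- On `[t_k, t_{k+1}]` the path `γ^D` is the linear interpolation of `γ(t_k)` and `γ(t_{k+1})`. -/
theorem Partition.interp_eq {V : Type*} [NormedAddCommGroup V] [NormedSpace ℝ V] {a b : ℝ}
    (D : Partition a b) (γ : ℝ → V) {k : ℕ} (hk : k < D.n) {t : ℝ}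
    (ht : t ∈ Set.Icc (D.pt k) (D.pt (k + 1))) :
    D.interp γ t = ((t - D.pt k) / (D.pt (k + 1) - D.pt k)) • γ (D.pt (k + 1)) +
      ((D.pt (k + 1) - t) / (D.pt (k + 1) - D.pt k)) • γ (D.pt k) := by
  have hlow : ∀ j < k,
      max 0 (min 1 ((t - D.pt j) / (D.pt (j + 1) - D.pt j))) = (1 : ℝ) := by
    intro j hj
    have h1 := D.lt_succ j (by omega)
    have h2 := D.pt_le (show j + 1 ≤ k by omega) hk.le
    have h3 : 1 ≤ (t - D.pt j) / (D.pt (j + 1) - D.pt j) := by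
      rw [le_div_iff₀ (by linarith)]; linarith [ht.1]
    rw [min_eq_left h3]; norm_num
  have hhigh : ∀ j, k < j → j < D.n →
      max 0 (min 1 ((t - D.pt j) / (D.pt (j + 1) - D.pt j))) = (0 : ℝ) := by
    intro j hj hjn
    have h1 := D.lt_succ j hjn
    have h2 := D.pt_le (show k + 1 ≤ j by omega) hjn.le
    have h3 : (t - D.pt j) / (D.pt (j + 1) - D.pt j) ≤ 0 :=
      div_nonpos_of_nonpos_of_nonneg (by linarith [ht.2]) (by linarith)
    exact max_eq_left ((min_le_right _ _).trans h3)
  have hsum : ∑ j ∈ Finset.range D.n,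
      (max 0 (min 1 ((t - D.pt j) / (D.pt (j + 1) - D.pt j)))) •
        (γ (D.pt (j + 1)) - γ (D.pt j)) =
      (γ (D.pt k) - γ (D.pt 0)) +
        ((t - D.pt k) / (D.pt (k + 1) - D.pt k)) • (γ (D.pt (k + 1)) - γ (D.pt k)) := by
    rw [← Finset.sum_subset (Finset.range_subset_range.2 (Nat.succ_le_of_lt hk)),
      Finset.sum_range_succ]
    · congr 1
      · rw [← Finset.sum_range_sub (fun j => γ (D.pt j))]
        refine Finset.sum_congr rfl fun j hj => ?_
        rw [hlow j (Finset.mem_range.1 hj), one_smul]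
      · have h1 := D.lt_succ k hk
        rw [min_eq_right, max_eq_right]
        · exact div_nonneg (by linarith [ht.1]) (by linarith)
        · rw [div_le_one (by linarith)]; linarith [ht.2]
    · intro j hj hj'
      rw [hhigh j (by simpa using hj') (Finset.mem_range.1 hj), zero_smul]
  have h1 := D.lt_succ k hk
  have hc : (D.pt (k + 1) - t) / (D.pt (k + 1) - D.pt k) =
      1 - (t - D.pt k) / (D.pt (k + 1) - D.pt k) := by
    have : D.pt (k + 1) - D.pt k ≠ 0 := by linarith
    field_simp; ring
  rw [Partition.interp, hsum, hc, smul_sub, sub_smul, one_smul]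
  abel

/-! ### Variation of functions on the triangle `{0 ≤ s ≤ t ≤ T}` and of paths

Paths are functions on `ℝ` of which only the restriction to `[0, T]` is used, and functions on the
triangle are functions of two real variables of which only the restriction to the triangle is
used. -/

section Variation

variable {E : Type*} [NormedAddCommGroup E]

/-- `∑_j ‖α(t_j, t_{j+1})‖^p`. -/
def varSum (p : ℝ) (α : ℝ → ℝ → E) {a b : ℝ} (D : Partition a b) : ℝ≥0∞ :=
  ∑ j ∈ Finset.range D.n, ‖α (D.pt j) (D.pt (j + 1))‖ₑ ^ p

/-- The `p`-variation of `α` on `[0, T]`, for `0 < p < ∞`. -/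
def pVar (p T : ℝ) (α : ℝ → ℝ → E) : ℝ≥0∞ :=
  (⨆ D : Partition 0 T, varSum p α D) ^ (1 / p)

/-- `ω_p(α, δ)`: as the `p`-variation, but over partitions of mesh at most `δ`. -/
def omegaVar (p T : ℝ) (α : ℝ → ℝ → E) (δ : ℝ) : ℝ≥0∞ :=
  (⨆ (D : Partition 0 T) (_ : D.mesh ≤ δ), varSum p α D) ^ (1 / p)

/-- The increments `(s, t) ↦ γ(t) - γ(s)` of a path. -/
def increments (γ : ℝ → E) (s t : ℝ) : E := γ t - γ s

/-- The triangle `{(s, t) | 0 ≤ s ≤ t ≤ T}`. -/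
def triangle (T : ℝ) : Set (ℝ × ℝ) := {q | 0 ≤ q.1 ∧ q.1 ≤ q.2 ∧ q.2 ≤ T}

/-- `α` is continuous on the triangle and vanishes on the diagonal. -/
def IsTriangleFun (T : ℝ) (α : ℝ → ℝ → E) : Prop :=
  ContinuousOn (fun q : ℝ × ℝ => α q.1 q.2) (triangle T) ∧ ∀ t ∈ Set.Icc 0 T, α t t = 0

/-- `α ∈ C^{0,p-var}`: a continuous function on the triangle, of vanishing `p`-variation. -/
def IsVanishingTriangleFun (p T : ℝ) (α : ℝ → ℝ → E) : Prop :=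
  IsTriangleFun T α ∧ Tendsto (omegaVar p T α) (𝓝[>] 0) (𝓝 0)

/-- `γ ∈ C^{p-var}([0, T])`: a continuous path of finite `p`-variation. -/
def IsFiniteVarPath (p T : ℝ) (γ : ℝ → E) : Prop :=
  ContinuousOn γ (Set.Icc 0 T) ∧ pVar p T (increments γ) < ∞

/-- `γ ∈ C^{0,p-var}([0, T])`: a continuous path of vanishing `p`-variation. -/
def IsVanishingVarPath (p T : ℝ) (γ : ℝ → E) : Prop :=
  ContinuousOn γ (Set.Icc 0 T) ∧ Tendsto (omegaVar p T (increments γ)) (𝓝[>] 0) (𝓝 0)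

end Variation

/-! ### Riemann–Stieltjes integrals -/

section RiemannStieltjes

variable {U V W : Type*} [NormedAddCommGroup V] [NormedAddCommGroup W]

/-- The Riemann sum `∑_j B(f(ξ_j), g(t_{j+1}) - g(t_j))`. -/
def rsSum (B : U → V → W) (f : ℝ → U) (g : ℝ → V) {a b : ℝ} (D : TaggedPartition a b) : W :=
  ∑ j ∈ Finset.range D.n, B (f (D.tag j)) (g (D.pt (j + 1)) - g (D.pt j))

/-- The Riemann–Stieltjes integral `∫_a^b B(f, dg)` exists and equals `I`: the Riemann sums tend to
`I` as the mesh tends to zero, for all choices of representative points. -/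
def HasRSIntegral (B : U → V → W) (f : ℝ → U) (g : ℝ → V) (a b : ℝ) (I : W) : Prop :=
  Tendsto (fun D : TaggedPartition a b => rsSum B f g D) (taggedMeshToZero a b) (𝓝 I)

/-- The value of the Riemann–Stieltjes integral `∫_a^b B(f, dg)` (meaningful if it exists). -/
def rsIntegral (B : U → V → W) (f : ℝ → U) (g : ℝ → V) (a b : ℝ) : W :=
  limUnder (taggedMeshToZero a b) (fun D : TaggedPartition a b => rsSum B f g D)

end RiemannStieltjes

/-! ### The Banach spaces `V ⊗ V` and `[V, V]` -/

section Tensor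

variable {V : Type*} [NormedAddCommGroup V] [NormedSpace ℝ V]

/-- A norm on the algebraic tensor product `V ⊗ V` with `‖v ⊗ w‖ ≤ ‖v‖ ‖w‖`. -/
structure TensorNorm (V : Type*) [NormedAddCommGroup V] [NormedSpace ℝ V] where
  toSeminorm : Seminorm ℝ (V ⊗[ℝ] V)
  eq_zero : ∀ x, toSeminorm x = 0 → x = 0
  tmul_le : ∀ v w : V, toSeminorm (v ⊗ₜ[ℝ] w) ≤ ‖v‖ * ‖w‖

/-- The algebraic tensor product `V ⊗ V`, to be normed by `N`. -/
def AlgTensor (_N : TensorNorm V) : Type _ := V ⊗[ℝ] V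

instance (N : TensorNorm V) : AddCommGroup (AlgTensor N) :=
  inferInstanceAs (AddCommGroup (V ⊗[ℝ] V))

instance (N : TensorNorm V) : Module ℝ (AlgTensor N) :=
  inferInstanceAs (Module ℝ (V ⊗[ℝ] V))

instance (N : TensorNorm V) : Norm (AlgTensor N) := ⟨fun x => N.toSeminorm x⟩

theorem algTensor_core (N : TensorNorm V) : NormedSpace.Core ℝ (AlgTensor N) where
  norm_nonneg x := apply_nonneg N.toSeminorm x
  norm_smul c x := map_smul_eq_mul N.toSeminorm c x
  norm_triangle x y := map_add_le_add N.toSeminorm x y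
  norm_eq_zero_iff x := ⟨N.eq_zero x, fun h => by subst h; exact map_zero N.toSeminorm⟩

instance (N : TensorNorm V) : NormedAddCommGroup (AlgTensor N) :=
  NormedAddCommGroup.ofCore (algTensor_core N)

instance (N : TensorNorm V) : NormedSpace ℝ (AlgTensor N) :=
  NormedSpace.ofCore (algTensor_core N)

/-- The Banach space `V ⊗ V`: the completion of the algebraic tensor product. -/
abbrev BanachTensor (N : TensorNorm V) : Type _ := UniformSpace.Completion (AlgTensor N)

/-- `[v, w] = v ⊗ w - w ⊗ v`, as an element of the algebraic tensor product. -/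
def algBracket (N : TensorNorm V) (v w : V) : AlgTensor N :=
  (v ⊗ₜ[ℝ] w - w ⊗ₜ[ℝ] v : V ⊗[ℝ] V)

/-- The Banach space `[V, V]`: the closure in `V ⊗ V` of the span of the brackets `[v, w]`. -/
def lieSquare (N : TensorNorm V) : Submodule ℝ (BanachTensor N) :=
  (Submodule.span ℝ
    (Set.range fun q : V × V => (algBracket N q.1 q.2 : BanachTensor N))).topologicalClosure

/-- `[v, w]`, as an element of `[V, V]`. -/
def bracket (N : TensorNorm V) (v w : V) : lieSquare N :=
  ⟨(algBracket N v w : BanachTensor N),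
    Submodule.le_topologicalClosure _ (Submodule.subset_span ⟨(v, w), rfl⟩)⟩

/-! ### Area and geometric `2`-rough paths -/

/-- The area `A(γ)(s, t) = ½ ∬_{s < u₁ < u₂ < t} [dγ(u₁), dγ(u₂)]` of a continuous path of bounded
variation, as an iterated Riemann–Stieltjes integral: the integral over `u₁ ∈ [s, u₂]` is
`γ(u₂) - γ(s)`. -/
def area (N : TensorNorm V) (γ : ℝ → V) (s t : ℝ) : lieSquare N :=
  (1 / 2 : ℝ) • rsIntegral (bracket N) (fun u => γ u - γ s) γ s t

/-- The `2`-rough norm `(‖γ‖_{2-var}² + ‖α‖_{1-var})^{1/2}` of a pair `(γ, α)`. -/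
def roughNorm (N : TensorNorm V) (T : ℝ) (γ : ℝ → V) (α : ℝ → ℝ → lieSquare N) : ℝ≥0∞ :=
  (pVar 2 T (increments γ) ^ (2 : ℝ) + pVar 1 T α) ^ (1 / 2 : ℝ)

/-- `(γ, α)` is a geometric `2`-rough path: it is the limit in `2`-rough norm of
`(γₙ, A(γₙ))` for continuous paths `γₙ` of bounded variation. -/
def IsGeometricRoughPath (N : TensorNorm V) (T : ℝ) (γ : ℝ → V) (α : ℝ → ℝ → lieSquare N) : Prop :=
  ContinuousOn γ (Set.Icc 0 T) ∧ IsTriangleFun T α ∧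
    ∃ γs : ℕ → ℝ → V, (∀ n, IsFiniteVarPath 1 T (γs n)) ∧
      Tendsto (fun n => roughNorm N T (fun t => γ t - γs n t)
        (fun s t => α s t - area N (γs n) s t)) atTop (𝓝 0)

/-- `γ ∈ 𝒢₂(V)`: the path `γ` is of vanishing `2`-variation and can be enhanced into a geometric
`2`-rough path. -/
def IsEnhancible (N : TensorNorm V) (T : ℝ) (γ : ℝ → V) : Prop :=
  IsVanishingVarPath 2 T γ ∧
    ∃ α : ℝ → ℝ → lieSquare N, IsVanishingTriangleFun 1 T α ∧ IsGeometricRoughPath N T γ α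

/-- `A(γ^D)` converges to `α` in `1`-variation as `|D| → 0`. -/
def InterpAreaTendsto (N : TensorNorm V) (T : ℝ) (γ : ℝ → V) (α : ℝ → ℝ → lieSquare N) : Prop :=
  Tendsto (fun D : Partition 0 T =>
    pVar 1 T (fun s t => area N (D.interp γ) s t - α s t)) (meshToZero 0 T) (𝓝 0)

end Tensor

end RoughArea

end

/-!
Every estimate in the proof is made on a single interval `[s, t]`, with a superadditive function of
intervals as the bound, and is then summed over an arbitrary partition by superadditivity alone
(`control_le_of_forall_le`). The basic superadditive function is `control p δ α s t`, the supremum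
of `∑ ‖α(t_j, t_{j+1})‖^p` over the partitions of `[s, t]` of mesh at most `δ`.

For a continuous path of bounded variation the integral that defines the area exists, because
Riemann sums over two partitions can be compared as double sums over pairs of cells
(`enorm_rsSum_sub_rsSum_le`). Hence the area satisfies Chen's relation
`A(s, u) = A(s, t) + A(t, u) + ½ [γ_{s,t}, γ_{t,u}]`, and it is of vanishing `1`-variation, being
bounded on `[s, t]` by the oscillation of the path times its variation. Both properties pass to
limits, so if `(γ, α)` is a geometric rough path then `α` satisfies Chen's relation with `γ`
and is of vanishing `1`-variation.

These two properties already give everything else. For the convergence of `A(γ^D)` to `α`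
(`IsChen.tendsto_pVar_areaOf_interp`), cut an interval `[s, t]` at its first and last points of `D`.
Between these two points `γ` and `γ^D` have the same increments over the cells and `A(γ^D)` vanishes
on the cells, so `α - A(γ^D)` is the sum of the values of `α` on the cells. On the two outer pieces
`A(γ^D)` vanishes and `α` is evaluated on a short interval. What remains are cross terms, products
of two increments of which at least one is over a short interval; by Young's inequality they are at
most `l x² + l⁻¹ y²` for every `l`, where the squares of the short increments add up to a small
quantity and those of the others to at most the finite `2`-variation of `γ`. In the same way the
Riemann sums for `∫ [γ(u) - γ(s), dγ(u)]` differ from `2 α(s, t)` only by terms inside the cells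
(`IsChen.hasRSIntegral`).

Conversely, if `A(γ^D)` converges to `α`, then the interpolations `γ^D` are themselves the required
approximations of bounded variation, since `γ^D → γ` in `2`-variation
(`Partition.control_sub_interp_le`).
-/

noncomputable section

namespace RoughArea

/-! ### Partitions and their mesh -/

section Partitions

variable {a b c : ℝ}

theorem Partition.le (D : Partition a b) : a ≤ b := by
  calc a = D.pt 0 := D.pt_zero.symm
    _ ≤ D.pt D.n := D.pt_le (Nat.zero_le _) le_rfl
    _ = b := D.pt_last

theorem Partition.left_le_pt (D : Partition a b) {j : ℕ} (hj : j ≤ D.n) : a ≤ D.pt j := by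
  calc a = D.pt 0 := D.pt_zero.symm
    _ ≤ D.pt j := D.pt_le (Nat.zero_le _) hj

theorem Partition.pt_le_right (D : Partition a b) {j : ℕ} (hj : j ≤ D.n) : D.pt j ≤ b := by
  calc D.pt j ≤ D.pt D.n := D.pt_le hj le_rfl
    _ = b := D.pt_last

theorem Partition.step_le_mesh (D : Partition a b) {i : ℕ} (hi : i < D.n) :
    D.pt (i + 1) - D.pt i ≤ D.mesh :=
  le_ciSup (f := fun i : Fin D.n => D.pt (i + 1) - D.pt i) (Set.finite_range _).bddAbove ⟨i, hi⟩

theorem Partition.mesh_nonneg (D : Partition a b) : 0 ≤ D.mesh :=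
  Real.iSup_nonneg fun i => sub_nonneg.2 (D.lt_succ i i.2).le

theorem Partition.mesh_le_iff (D : Partition a b) {δ : ℝ} (hδ : 0 ≤ δ) :
    D.mesh ≤ δ ↔ ∀ i < D.n, D.pt (i + 1) - D.pt i ≤ δ :=
  ⟨fun h _ hi => (D.step_le_mesh hi).trans h,
    fun h => Real.iSup_le (fun i => h i i.2) hδ⟩

theorem Partition.mesh_le_length (D : Partition a b) : D.mesh ≤ b - a :=
  (D.mesh_le_iff (sub_nonneg.2 D.le)).2 fun i hi => by
    have h1 := D.left_le_pt hi.le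
    have h2 := D.pt_le_right (Nat.succ_le_of_lt hi)
    simp only [Nat.succ_eq_add_one] at h2
    linarith

/-- Two points of `[a, b]` either lie in one cell of the partition, or in two cells of which the
second is to the right of the first. -/
theorem Partition.exists_cells (D : Partition a b) (hab : a < b) {s t : ℝ} (hs : a ≤ s)
    (hst : s ≤ t) (ht : t ≤ b) :
    (∃ k < D.n, D.pt k ≤ s ∧ t ≤ D.pt (k + 1)) ∨
      ∃ k l, k < l ∧ l < D.n ∧ (D.pt k ≤ s ∧ s ≤ D.pt (k + 1)) ∧
        (D.pt l ≤ t ∧ t ≤ D.pt (l + 1)) := by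
  have cell : ∀ x, a ≤ x → x ≤ b → ∃ k < D.n, D.pt k ≤ x ∧ x ≤ D.pt (k + 1) := by
    intro x hax hxb
    have hn : 0 < D.n := by
      rcases Nat.eq_zero_or_pos D.n with h | h
      · have h1 := D.pt_last
        rw [h, D.pt_zero] at h1
        exact absurd h1 hab.ne
      · exact h
    have hex : ∃ k, x ≤ D.pt (k + 1) :=
      ⟨D.n - 1, by rw [Nat.sub_add_cancel hn, D.pt_last]; exact hxb⟩
    classical
    refine ⟨Nat.find hex, ?_, ?_, Nat.find_spec hex⟩
    · have : Nat.find hex ≤ D.n - 1 :=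
        Nat.find_min' hex (by rw [Nat.sub_add_cancel hn, D.pt_last]; exact hxb)
      omega
    · rcases Nat.eq_zero_or_pos (Nat.find hex) with h | h
      · rw [h, D.pt_zero]; exact hax
      · have := Nat.find_min hex (m := Nat.find hex - 1) (by omega)
        rw [Nat.sub_add_cancel h] at this
        exact (not_le.1 this).le
  obtain ⟨k, hk, hks, hks'⟩ := cell s hs (hst.trans ht)
  obtain ⟨l, hl, hlt, hlt'⟩ := cell t (hs.trans hst) ht
  rcases lt_trichotomy k l with h | h | h
  · exact Or.inr ⟨k, l, h, hl, ⟨hks, hks'⟩, hlt, hlt'⟩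
  · subst h
    exact Or.inl ⟨k, hk, hks, hlt'⟩
  · have h1 := D.pt_le (show l + 1 ≤ k by omega) hk.le
    exact Or.inl ⟨k, hk, hks, by linarith⟩

/-- The partition of `[a, b]` whose only cell is `[a, b]`. -/
def Partition.single (h : a < b) : Partition a b where
  n := 1
  pt i := if i = 0 then a else b
  pt_zero := by simp
  pt_last := by simp
  lt_succ i hi := by
    obtain rfl : i = 0 := by omega
    simpa using h

/-- The partition of a one-point interval. -/
def Partition.point (a : ℝ) : Partition a a where
  n := 0
  pt _ := a
  pt_zero := rfl
  pt_last := rfl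
  lt_succ i hi := absurd hi (Nat.not_lt_zero i)

/-- The partition of `[a, b]` into `n + 1` cells of equal length. -/
def Partition.uniform (h : a < b) (n : ℕ) : Partition a b where
  n := n + 1
  pt i := a + i * ((b - a) / (n + 1))
  pt_zero := by simp
  pt_last := by
    push_cast
    field_simp
    ring
  lt_succ i _ := by
    have : 0 < (b - a) / ((n : ℝ) + 1) := div_pos (sub_pos.2 h) (by positivity)
    push_cast
    linarith

theorem Partition.mesh_uniform_le (h : a < b) (n : ℕ) :
    (Partition.uniform h n).mesh ≤ (b - a) / (n + 1) := by
  have : 0 < (b - a) / ((n : ℝ) + 1) := div_pos (sub_pos.2 h) (by positivity)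
  refine (Partition.mesh_le_iff _ this.le).2 fun i _ => le_of_eq ?_
  simp only [Partition.uniform]
  push_cast
  ring

theorem tendsto_uniform_meshToZero (h : a < b) :
    Tendsto (fun n => Partition.uniform h n) atTop (meshToZero a b) := by
  refine tendsto_comap_iff.2 ?_
  refine squeeze_zero (fun n => Partition.mesh_nonneg _) (Partition.mesh_uniform_le h) ?_
  exact tendsto_const_div_atTop_nhds_zero_nat (b - a) |>.comp (tendsto_add_atTop_nat 1) |>.congr
    fun n => by simp

/-- The concatenation of partitions of `[a, b]` and `[b, c]`. -/
def Partition.concat (D : Partition a b) (D' : Partition b c) : Partition a c where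
  n := D.n + D'.n
  pt i := if i ≤ D.n then D.pt i else D'.pt (i - D.n)
  pt_zero := by simp [D.pt_zero]
  pt_last := by
    split_ifs with h
    · have h0 : D'.n = 0 := by omega
      have h1 := D'.pt_last
      rw [h0, D'.pt_zero] at h1
      rw [h0, add_zero, D.pt_last, h1]
    · rw [Nat.add_sub_cancel_left, D'.pt_last]
  lt_succ i hi := by
    rcases lt_trichotomy i D.n with h | h | h
    · rw [if_pos h.le, if_pos (Nat.succ_le_of_lt h)]
      exact D.lt_succ i h
    · subst h
      rw [if_pos le_rfl, if_neg (by omega), Nat.add_sub_cancel_left, D.pt_last]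
      calc b = D'.pt 0 := D'.pt_zero.symm
        _ < D'.pt 1 := D'.lt_succ 0 (by omega)
    · rw [if_neg (by omega), if_neg (by omega), Nat.sub_add_comm h.le]
      exact D'.lt_succ _ (by omega)

theorem Partition.concat_pt_left (D : Partition a b) (D' : Partition b c) {i : ℕ} (hi : i ≤ D.n) :
    (D.concat D').pt i = D.pt i := if_pos hi

theorem Partition.concat_pt_right (D : Partition a b) (D' : Partition b c) (i : ℕ) :
    (D.concat D').pt (D.n + i) = D'.pt i := by
  simp only [Partition.concat]
  split_ifs with h
  · obtain rfl : i = 0 := by omega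
    rw [add_zero, D.pt_last, D'.pt_zero]
  · rw [Nat.add_sub_cancel_left]

/-- A sum over the cells of a concatenation splits into the sums over the two partitions. -/
theorem Partition.sum_concat {M : Type*} [AddCommMonoid M] (D : Partition a b)
    (D' : Partition b c) (f : ℝ → ℝ → M) :
    ∑ j ∈ Finset.range (D.concat D').n, f ((D.concat D').pt j) ((D.concat D').pt (j + 1)) =
      ∑ j ∈ Finset.range D.n, f (D.pt j) (D.pt (j + 1)) +
        ∑ j ∈ Finset.range D'.n, f (D'.pt j) (D'.pt (j + 1)) := by
  rw [show (D.concat D').n = D.n + D'.n from rfl, Finset.sum_range_add]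
  congr 1
  · refine Finset.sum_congr rfl fun j hj => ?_
    have hj := Finset.mem_range.1 hj
    rw [D.concat_pt_left D' hj.le, D.concat_pt_left D' (Nat.succ_le_of_lt hj)]
  · refine Finset.sum_congr rfl fun j _ => ?_
    rw [add_assoc, D.concat_pt_right, D.concat_pt_right]

theorem Partition.mesh_concat_le (D : Partition a b) (D' : Partition b c) {δ : ℝ}
    (h : D.mesh ≤ δ) (h' : D'.mesh ≤ δ) : (D.concat D').mesh ≤ δ := by
  have hδ := D.mesh_nonneg.trans h
  refine (Partition.mesh_le_iff _ hδ).2 fun i hi => ?_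
  rcases lt_or_ge i D.n with hi' | hi'
  · rw [D.concat_pt_left D' hi'.le, D.concat_pt_left D' (Nat.succ_le_of_lt hi')]
    exact (D.step_le_mesh hi').trans h
  · obtain ⟨k, rfl⟩ := Nat.exists_eq_add_of_le hi'
    rw [add_assoc, D.concat_pt_right, D.concat_pt_right]
    exact (D'.step_le_mesh (by
      change D.n + k < D.n + D'.n at hi
      omega)).trans h'

/-- A partition with the left end points of the cells as representative points. -/
def Partition.leftTagged (D : Partition a b) : TaggedPartition a b where
  toPartition := D
  tag := D.pt
  tag_mem i hi := ⟨le_rfl, (D.lt_succ i hi).le⟩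

/-- The concatenation of tagged partitions of `[a, b]` and `[b, c]`. -/
def TaggedPartition.concat (D : TaggedPartition a b) (D' : TaggedPartition b c) :
    TaggedPartition a c where
  toPartition := D.toPartition.concat D'.toPartition
  tag i := if i < D.n then D.tag i else D'.tag (i - D.n)
  tag_mem i hi := by
    split_ifs with h
    · rw [D.concat_pt_left _ h.le, D.concat_pt_left _ (Nat.succ_le_of_lt h)]
      exact D.tag_mem i h
    · obtain ⟨k, rfl⟩ := Nat.exists_eq_add_of_le (not_lt.1 h)
      rw [add_assoc, Partition.concat_pt_right, Partition.concat_pt_right, Nat.add_sub_cancel_left]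
      refine D'.tag_mem k ?_
      change D.n + k < D.n + D'.n at hi
      omega

theorem eventually_meshToZero {P : Partition a b → Prop} :
    (∀ᶠ D in meshToZero a b, P D) ↔ ∃ δ > 0, ∀ D : Partition a b, D.mesh ≤ δ → P D := by
  rw [meshToZero, ((Metric.nhds_basis_closedBall (x := (0 : ℝ))).comap _).eventually_iff]
  simp only [Set.mem_preimage, Metric.mem_closedBall, Real.dist_eq, sub_zero,
    abs_of_nonneg (Partition.mesh_nonneg _)]

theorem eventually_taggedMeshToZero {P : TaggedPartition a b → Prop} :
    (∀ᶠ D in taggedMeshToZero a b, P D) ↔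
      ∃ δ > 0, ∀ D : TaggedPartition a b, D.mesh ≤ δ → P D := by
  rw [taggedMeshToZero, ((Metric.nhds_basis_closedBall (x := (0 : ℝ))).comap _).eventually_iff]
  simp only [Set.mem_preimage, Metric.mem_closedBall, Real.dist_eq, sub_zero,
    abs_of_nonneg (Partition.mesh_nonneg _)]

theorem Partition.exists_mesh_le (h : a ≤ b) {δ : ℝ} (hδ : 0 < δ) :
    ∃ D : Partition a b, D.mesh ≤ δ := by
  rcases h.eq_or_lt with rfl | h
  · exact ⟨Partition.point a, (Partition.mesh_le_iff _ hδ.le).2 fun i hi => absurd hi (by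
      simp [Partition.point])⟩
  · exact ((tendsto_uniform_meshToZero h).eventually
      (eventually_meshToZero.2 ⟨δ, hδ, fun D (hD : D.mesh ≤ δ) => hD⟩)).exists.imp'
      (fun n => Partition.uniform h n) fun _ h => h

/-- Limits along `|D| → 0` are unique, also over a one-point interval, whose only partition has no
cells. -/
theorem taggedMeshToZero_neBot (h : a ≤ b) : (taggedMeshToZero a b).NeBot := by
  refine ⟨fun hbot => ?_⟩
  have : ∀ᶠ _ in taggedMeshToZero a b, False := by rw [hbot]; exact eventually_bot
  obtain ⟨δ, hδ, H⟩ := eventually_taggedMeshToZero.1 this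
  obtain ⟨D, hD⟩ := Partition.exists_mesh_le h hδ
  exact H D.leftTagged hD

end Partitions

/-! ### Superadditive functions of intervals -/

/-- Superadditivity of a function of intervals: `w(s, t) + w(t, u) ≤ w(s, u)`. -/
def IsSuperadditive (w : ℝ → ℝ → ℝ≥0∞) : Prop :=
  ∀ s t u, s ≤ t → t ≤ u → w s t + w t u ≤ w s u

namespace IsSuperadditive

variable {w w' : ℝ → ℝ → ℝ≥0∞}

theorem add (h : IsSuperadditive w) (h' : IsSuperadditive w') :
    IsSuperadditive fun s t => w s t + w' s t := fun s t u hst htu => by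
  calc w s t + w' s t + (w t u + w' t u) = w s t + w t u + (w' s t + w' t u) := by ring
    _ ≤ w s u + w' s u := add_le_add (h s t u hst htu) (h' s t u hst htu)

theorem const_mul (h : IsSuperadditive w) (c : ℝ≥0∞) :
    IsSuperadditive fun s t => c * w s t := fun s t u hst htu => by
  rw [← mul_add]
  exact mul_le_mul_right (h s t u hst htu) c

theorem sum {ι : Type*} (S : Finset ι) {w : ι → ℝ → ℝ → ℝ≥0∞}
    (h : ∀ i ∈ S, IsSuperadditive (w i)) : IsSuperadditive fun s t => ∑ i ∈ S, w i s t :=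
  fun s t u hst htu => by
    rw [← Finset.sum_add_distrib]
    exact Finset.sum_le_sum fun i hi => h i hi s t u hst htu

theorem of_monotone {f : ℝ → ℝ} (hf : Monotone f) :
    IsSuperadditive fun s t => ENNReal.ofReal (f t - f s) := fun s t u hst htu => by
  rw [← ENNReal.ofReal_add (sub_nonneg.2 (hf hst)) (sub_nonneg.2 (hf htu))]
  exact ENNReal.ofReal_le_ofReal (by linarith)

theorem mono (h : IsSuperadditive w) {s s' t' t : ℝ} (hs : s ≤ s') (hst : s' ≤ t') (ht : t' ≤ t) :
    w s' t' ≤ w s t :=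
  calc w s' t' ≤ w s s' + w s' t' := le_add_self
    _ ≤ w s t' := h _ _ _ hs hst
    _ ≤ w s t' + w t' t := le_self_add
    _ ≤ w s t := h _ _ _ (hs.trans hst) ht

theorem sum_le (h : IsSuperadditive w) {u : ℕ → ℝ} {n : ℕ} (hu : ∀ i < n, u i ≤ u (i + 1)) :
    ∑ i ∈ Finset.range n, w (u i) (u (i + 1)) ≤ w (u 0) (u n) := by
  have h0 : ∀ k ≤ n, u 0 ≤ u k := by
    intro k hk
    induction k with
    | zero => exact le_rfl
    | succ k ih => exact (ih (by omega)).trans (hu k (by omega))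
  have key : ∀ k ≤ n, ∑ i ∈ Finset.range k, w (u i) (u (i + 1)) ≤ w (u 0) (u k) := by
    intro k hk
    induction k with
    | zero => simp
    | succ k ih =>
      rw [Finset.sum_range_succ]
      exact (add_le_add_left (ih (by omega)) _).trans
        (h _ _ _ (h0 k (by omega)) (hu k (by omega)))
  exact key n le_rfl

theorem sum_partition_le (h : IsSuperadditive w) {a b : ℝ} (D : Partition a b) :
    ∑ i ∈ Finset.range D.n, w (D.pt i) (D.pt (i + 1)) ≤ w a b := by
  have := h.sum_le fun i hi => (D.lt_succ i hi).le
  rwa [D.pt_zero, D.pt_last] at this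

end IsSuperadditive

/-! ### Variation over subintervals -/

section Control

variable {E : Type*} [NormedAddCommGroup E]

/-- The supremum of `∑_j ‖α(t_j, t_{j+1})‖^p` over the partitions of `[s, t]` of mesh at most `δ`.
Regarded as a function of `(s, t)` it is superadditive, and it dominates `‖α(s, t)‖^p` when
`t - s ≤ δ`. -/
def control (p δ : ℝ) (α : ℝ → ℝ → E) (s t : ℝ) : ℝ≥0∞ :=
  ⨆ (D : Partition s t) (_ : D.mesh ≤ δ), varSum p α D

theorem varSum_le_control (p : ℝ) {δ : ℝ} (α : ℝ → ℝ → E) {a b : ℝ} (D : Partition a b)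
    (hD : D.mesh ≤ δ) : varSum p α D ≤ control p δ α a b :=
  le_iSup₂ (f := fun (D : Partition a b) (_ : D.mesh ≤ δ) => varSum p α D) D hD

theorem isSuperadditive_control (p : ℝ) {δ : ℝ} (hδ : 0 < δ) (α : ℝ → ℝ → E) :
    IsSuperadditive (control p δ α) := by
  intro s t u hst htu
  refine ENNReal.biSup_add_biSup_le' (Partition.exists_mesh_le hst hδ)
    (Partition.exists_mesh_le htu hδ) fun D hD D' hD' => ?_
  exact (D.sum_concat D' fun x y => ‖α x y‖ₑ ^ p).symm.le.trans
    (varSum_le_control p α (D.concat D') (D.mesh_concat_le D' hD hD'))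

theorem enorm_rpow_le_control (p : ℝ) {δ : ℝ} (α : ℝ → ℝ → E) {s t : ℝ} (hst : s < t)
    (hδ : t - s ≤ δ) : ‖α s t‖ₑ ^ p ≤ control p δ α s t := by
  refine le_trans (le_of_eq ?_) (varSum_le_control p α (Partition.single hst)
    ((Partition.mesh_le_length _).trans hδ))
  simp [varSum, Partition.single]

theorem enorm_increments_sq_le_control {δ : ℝ} (γ : ℝ → E) {s t : ℝ} (hst : s ≤ t)
    (hδ : t - s ≤ δ) : ‖γ t - γ s‖ₑ ^ 2 ≤ control 2 δ (increments γ) s t := by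
  rcases hst.eq_or_lt with rfl | h
  · simp
  · rw [← ENNReal.rpow_two]
    exact enorm_rpow_le_control 2 (increments γ) h hδ

theorem enorm_increments_le_control {δ : ℝ} (γ : ℝ → E) {s t : ℝ} (hst : s ≤ t)
    (hδ : t - s ≤ δ) : ‖γ t - γ s‖ₑ ≤ control 1 δ (increments γ) s t := by
  rcases hst.eq_or_lt with rfl | h
  · simp
  · simpa [increments] using enorm_rpow_le_control 1 (increments γ) h hδ

theorem control_mono_mesh (p : ℝ) {δ δ' : ℝ} (h : δ ≤ δ') (α : ℝ → ℝ → E) (s t : ℝ) :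
    control p δ α s t ≤ control p δ' α s t :=
  iSup₂_le fun D hD => varSum_le_control p α D (hD.trans h)

theorem omegaVar_eq (p T : ℝ) (α : ℝ → ℝ → E) (δ : ℝ) :
    omegaVar p T α δ = control p δ α 0 T ^ (1 / p) := rfl

theorem pVar_eq (p T : ℝ) (α : ℝ → ℝ → E) : pVar p T α = control p T α 0 T ^ (1 / p) := by
  rw [pVar, control]
  congr 1
  refine iSup_congr fun D => ?_
  rw [iSup_pos]
  simpa using D.mesh_le_length

/-- A superadditive function dominating `‖α(s, t)‖^p` on all intervals of length at most `δ` bounds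
the sums over partitions of mesh at most `δ`. -/
theorem control_le_of_forall_le {p δ a b : ℝ} {α : ℝ → ℝ → E} {w : ℝ → ℝ → ℝ≥0∞}
    (hw : IsSuperadditive w)
    (h : ∀ s t, a ≤ s → s ≤ t → t ≤ b → t - s ≤ δ → ‖α s t‖ₑ ^ p ≤ w s t) :
    control p δ α a b ≤ w a b := by
  refine iSup₂_le fun D hD => (Finset.sum_le_sum fun j hj => ?_).trans (hw.sum_partition_le D)
  have hj := Finset.mem_range.1 hj
  exact h _ _ (D.left_le_pt hj.le) (D.lt_succ j hj).le
    (D.pt_le_right (Nat.succ_le_of_lt hj)) ((D.step_le_mesh hj).trans hD)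

theorem control_one_add_le {δ a b : ℝ} {α β β' : ℝ → ℝ → E}
    (h : ∀ s t, a ≤ s → s ≤ t → t ≤ b → ‖α s t‖ₑ ≤ ‖β s t‖ₑ + ‖β' s t‖ₑ) :
    control 1 δ α a b ≤ control 1 δ β a b + control 1 δ β' a b := by
  refine iSup₂_le fun D hD => ?_
  refine le_trans ?_ (add_le_add (varSum_le_control 1 β D hD) (varSum_le_control 1 β' D hD))
  simp only [varSum, ENNReal.rpow_one]
  rw [← Finset.sum_add_distrib]
  refine Finset.sum_le_sum fun j hj => ?_
  have hj := Finset.mem_range.1 hj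
  exact h _ _ (D.left_le_pt hj.le) (D.lt_succ j hj).le (D.pt_le_right (Nat.succ_le_of_lt hj))

/-- Vanishing `p`-variation, in terms of the superadditive function `control`. -/
theorem tendsto_omegaVar_iff {p T : ℝ} (hp : 0 < p) {α : ℝ → ℝ → E} :
    Tendsto (omegaVar p T α) (𝓝[>] 0) (𝓝 0) ↔
      ∀ ε > 0, ∃ δ > 0, control p δ α 0 T ≤ ε := by
  have hp' : 0 < 1 / p := by positivity
  rw [ENNReal.tendsto_nhds_zero]
  constructor
  · intro h ε hε
    obtain ⟨δ, hδ, hδ'⟩ := ((h (ε ^ (1 / p)) (by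
      rcases eq_or_ne ε ∞ with rfl | hε'
      · rw [ENNReal.top_rpow_of_pos hp']; exact ENNReal.zero_lt_top
      · exact ENNReal.rpow_pos hε hε')).and self_mem_nhdsWithin).exists
    refine ⟨δ, hδ', ?_⟩
    rwa [omegaVar_eq, ENNReal.rpow_le_rpow_iff hp'] at hδ
  · intro h ε hε
    obtain ⟨δ, hδ, hδ'⟩ := h (ε ^ p) (by
      rcases eq_or_ne ε ∞ with rfl | hε'
      · rw [ENNReal.top_rpow_of_pos hp]; exact ENNReal.zero_lt_top
      · exact ENNReal.rpow_pos hε hε')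
    filter_upwards [Ioc_mem_nhdsGT hδ] with δ' hδ''
    rw [omegaVar_eq]
    calc control p δ' α 0 T ^ (1 / p) ≤ (ε ^ p) ^ (1 / p) :=
          ENNReal.rpow_le_rpow ((control_mono_mesh p hδ''.2 α 0 T).trans hδ') hp'.le
      _ = ε := by rw [← ENNReal.rpow_mul, mul_one_div_cancel hp.ne', ENNReal.rpow_one]

/-- A continuous path of vanishing `2`-variation has finite `2`-variation: with `M` a bound for
`‖γ‖`, the superadditive function `control 2 δ γ s t + (4 M² / δ) (t - s)` dominates `‖γ_{s,t}‖²`,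
by its first term on intervals of length at most `δ` and by its second term on the others. -/
theorem IsVanishingVarPath.control_two_lt_top {T : ℝ} {γ : ℝ → E}
    (hγ : IsVanishingVarPath 2 T γ) : control 2 T (increments γ) 0 T < ∞ := by
  obtain ⟨δ, hδ, h1⟩ := (tendsto_omegaVar_iff two_pos).1 hγ.2 1 one_pos
  obtain ⟨M, hM⟩ := isCompact_Icc.exists_bound_of_continuousOn hγ.1
  have hw : IsSuperadditive fun s t => control 2 δ (increments γ) s t +
      ENNReal.ofReal ((2 * M) ^ 2 / δ) * ENNReal.ofReal (id t - id s) :=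
    (isSuperadditive_control 2 hδ _).add ((IsSuperadditive.of_monotone monotone_id).const_mul _)
  refine (control_le_of_forall_le hw fun s t hs hst ht _ => ?_).trans_lt
    (ENNReal.add_lt_top.2 ⟨h1.trans_lt ENNReal.one_lt_top,
      ENNReal.mul_lt_top ENNReal.ofReal_lt_top ENNReal.ofReal_lt_top⟩)
  rw [ENNReal.rpow_two]
  by_cases hd : t - s ≤ δ
  · exact (enorm_increments_sq_le_control γ hst hd).trans le_self_add
  · refine le_trans ?_ le_add_self
    have hn : ‖γ t - γ s‖ ≤ 2 * M := by
      have h2 := hM t ⟨hs.trans hst, ht⟩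
      have h3 := hM s ⟨hs, hst.trans ht⟩
      exact (norm_sub_le _ _).trans (by linarith)
    rw [increments, ← ofReal_norm, ← ENNReal.ofReal_pow (norm_nonneg _),
      ← ENNReal.ofReal_mul (by positivity)]
    refine ENNReal.ofReal_le_ofReal ?_
    calc ‖γ t - γ s‖ ^ 2 ≤ (2 * M) ^ 2 := by gcongr
      _ = (2 * M) ^ 2 / δ * δ := by field_simp
      _ ≤ (2 * M) ^ 2 / δ * (t - s) := by
        gcongr
        exact (not_le.1 hd).le

end Control

/-! ### Riemann–Stieltjes integrals of continuous functions against paths of bounded variation -/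

section Increments

variable {V W : Type*} [NormedAddCommGroup V] [NormedAddCommGroup W] {a b : ℝ}

/-- The increment of `g` over the intersection of `[p, q]` and `[x, y]`. -/
def cellIncrement (g : ℝ → V) (p q x y : ℝ) : V :=
  g (max p (min q y)) - g (max p (min q x))

theorem sum_cellIncrement_right (g : ℝ → V) (D : Partition a b) {p q : ℝ} (hp : a ≤ p)
    (hpq : p ≤ q) (hq : q ≤ b) :
    ∑ k ∈ Finset.range D.n, cellIncrement g p q (D.pt k) (D.pt (k + 1)) = g q - g p := by
  rw [show (∑ k ∈ Finset.range D.n, cellIncrement g p q (D.pt k) (D.pt (k + 1))) = _ from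
    Finset.sum_range_sub (fun k => g (max p (min q (D.pt k)))) D.n, D.pt_last, D.pt_zero,
    min_eq_left hq, max_eq_right hpq, min_eq_right (hp.trans hpq), max_eq_left hp]

theorem sum_cellIncrement_left (g : ℝ → V) (D : Partition a b) {x y : ℝ}
    (hx : x ∈ Set.Icc a b) (hy : y ∈ Set.Icc a b) :
    ∑ j ∈ Finset.range D.n, cellIncrement g (D.pt j) (D.pt (j + 1)) x y = g y - g x := by
  -- The increments of `g` over the intersections of `[a, z]` with the first `m` cells.
  have key : ∀ z, a ≤ z → ∀ m ≤ D.n,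
      ∑ j ∈ Finset.range m, (g (max (D.pt j) (min (D.pt (j + 1)) z)) - g (D.pt j)) =
        g (min z (D.pt m)) - g a := by
    intro z hz m hm
    induction m with
    | zero => simp [D.pt_zero, min_eq_right hz]
    | succ m ih =>
      have h1 := (D.lt_succ m (by omega)).le
      rw [Finset.sum_range_succ, ih (by omega)]
      rcases le_total z (D.pt m) with h | h
      · rw [min_eq_left h, min_eq_right (h.trans h1), max_eq_left h, min_eq_left (h.trans h1)]
        abel
      · rw [min_eq_right h, max_eq_right (le_min h1 h), min_comm z]
        abel
  have hsub : ∀ j, cellIncrement g (D.pt j) (D.pt (j + 1)) x y =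
      (g (max (D.pt j) (min (D.pt (j + 1)) y)) - g (D.pt j)) -
        (g (max (D.pt j) (min (D.pt (j + 1)) x)) - g (D.pt j)) := fun j => by
    rw [cellIncrement]; abel
  simp only [hsub]
  rw [Finset.sum_sub_distrib, key y hy.1 _ le_rfl, key x hx.1 _ le_rfl, D.pt_last,
    min_eq_left hy.2, min_eq_left hx.2]
  abel

theorem cellIncrement_eq_zero (g : ℝ → V) {p q x y : ℝ} (hpq : p ≤ q) (hxy : x ≤ y)
    (h : q < x ∨ y < p) : cellIncrement g p q x y = 0 := by
  rw [cellIncrement]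
  rcases h with h | h
  · rw [min_eq_left h.le, min_eq_left (h.le.trans hxy), sub_self]
  · rw [min_eq_right (h.le.trans hpq), max_eq_left h.le,
      min_eq_right ((hxy.trans h.le).trans hpq), max_eq_left (hxy.trans h.le), sub_self]

theorem sum_sum_enorm_cellIncrement_le (g : ℝ → V) (D D' : Partition a b) {L : ℝ} (hL : 0 < L)
    (hab : b - a ≤ L) :
    ∑ j ∈ Finset.range D.n, ∑ k ∈ Finset.range D'.n,
      ‖cellIncrement g (D.pt j) (D.pt (j + 1)) (D'.pt k) (D'.pt (k + 1))‖ₑ ≤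
      control 1 L (increments g) a b := by
  have hw := isSuperadditive_control 1 hL (increments g)
  refine (Finset.sum_le_sum fun j hj => ?_).trans (hw.sum_partition_le D)
  have hj := Finset.mem_range.1 hj
  have hj1 := D.left_le_pt hj.le
  have hj2 := D.pt_le_right (Nat.succ_le_of_lt hj)
  have hj3 := (D.lt_succ j hj).le
  rw [Nat.succ_eq_add_one] at hj2
  set p := D.pt j
  set q := D.pt (j + 1)
  have hmono : ∀ x y, x ≤ y → max p (min q x) ≤ max p (min q y) := fun x y hxy =>
    max_le_max le_rfl (min_le_min le_rfl hxy)
  have hsum := hw.sum_le (u := fun k => max p (min q (D'.pt k))) (n := D'.n)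
    fun k hk => hmono _ _ (D'.lt_succ k hk).le
  simp only [D'.pt_zero, D'.pt_last] at hsum
  rw [min_eq_left hj2, max_eq_right hj3, min_eq_right (hj1.trans hj3), max_eq_left hj1] at hsum
  refine (Finset.sum_le_sum fun k hk => ?_).trans hsum
  have hk := Finset.mem_range.1 hk
  refine enorm_increments_le_control g (hmono _ _ (D'.lt_succ k hk).le) ?_
  have h1 : max p (min q (D'.pt (k + 1))) ≤ q := max_le hj3 (min_le_left _ _)
  have h2 : p ≤ max p (min q (D'.pt k)) := le_max_left _ _
  linarith

/-- Uniform continuity on a compact interval, in terms of extended norms. -/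
theorem exists_modulus {f : ℝ → V} (hf : ContinuousOn f (Set.Icc a b)) {ε : ℝ≥0∞} (hε : 0 < ε) :
    ∃ δ > 0, ∀ x ∈ Set.Icc a b, ∀ y ∈ Set.Icc a b, |x - y| ≤ δ → ‖f x - f y‖ₑ ≤ ε := by
  obtain ⟨ε', hε', hlt⟩ := ENNReal.lt_iff_exists_nnreal_btwn.1 hε
  have hu := isCompact_Icc.uniformContinuousOn_of_continuous hf
  obtain ⟨δ, hδ, h⟩ := Metric.uniformContinuousOn_iff.1 hu ε' (by exact_mod_cast hε')
  refine ⟨δ / 2, half_pos hδ, fun x hx y hy hxy => ?_⟩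
  have h1 := h x hx y hy (by rw [Real.dist_eq]; linarith)
  rw [dist_eq_norm] at h1
  rw [← ofReal_norm]
  exact (ENNReal.ofReal_le_of_le_toReal (by simpa using h1.le)).trans hlt.le

theorem HasRSIntegral.rsIntegral_eq {U : Type*} {B : U → V → W} {f : ℝ → U} {g : ℝ → V} (hab : a ≤ b) {I : W}
    (hI : HasRSIntegral B f g a b I) : rsIntegral B f g a b = I :=
  have := taggedMeshToZero_neBot hab
  hI.limUnder_eq

theorem IsFiniteVarPath.control_lt_top {T : ℝ} {γ : ℝ → V} (hγ : IsFiniteVarPath 1 T γ) :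
    control 1 T (increments γ) 0 T < ∞ := by
  have := hγ.2
  rw [pVar_eq] at this
  simpa using this

end Increments

section RiemannStieltjes

variable {U V W : Type*} [NormedAddCommGroup U] [NormedSpace ℝ U] [NormedAddCommGroup V]
  [NormedSpace ℝ V] [NormedAddCommGroup W] [NormedSpace ℝ W] {a b c : ℝ}

theorem enorm_apply_apply_le (B : U →L[ℝ] V →L[ℝ] W) (v : U) (w : V) :
    ‖B v w‖ₑ ≤ ‖B‖ₑ * (‖v‖ₑ * ‖w‖ₑ) :=
  calc ‖B v w‖ₑ ≤ ‖B v‖ₑ * ‖w‖ₑ := (B v).le_opENorm w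
    _ ≤ ‖B‖ₑ * ‖v‖ₑ * ‖w‖ₑ := by gcongr; exact B.le_opENorm v
    _ = ‖B‖ₑ * (‖v‖ₑ * ‖w‖ₑ) := mul_assoc _ _ _

theorem rsSum_concat (B : U →L[ℝ] V →L[ℝ] W) (f : ℝ → U) (g : ℝ → V) (D : TaggedPartition a b)
    (D' : TaggedPartition b c) :
    rsSum (fun v w => B v w) f g (D.concat D') =
      rsSum (fun v w => B v w) f g D + rsSum (fun v w => B v w) f g D' := by
  simp only [rsSum, TaggedPartition.concat]
  rw [show (D.toPartition.concat D'.toPartition).n = D.n + D'.n from rfl, Finset.sum_range_add]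
  congr 1
  · refine Finset.sum_congr rfl fun j hj => ?_
    have hj := Finset.mem_range.1 hj
    rw [if_pos hj, D.concat_pt_left _ hj.le, D.concat_pt_left _ (Nat.succ_le_of_lt hj)]
  · refine Finset.sum_congr rfl fun j _ => ?_
    rw [if_neg (by omega), add_assoc, Partition.concat_pt_right, Partition.concat_pt_right,
      Nat.add_sub_cancel_left]

theorem TaggedPartition.tag_mem_Icc (D : TaggedPartition a b) {j : ℕ} (hj : j < D.n) :
    D.tag j ∈ Set.Icc a b :=
  ⟨(D.left_le_pt hj.le).trans (D.tag_mem j hj).1,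
    (D.tag_mem j hj).2.trans (D.pt_le_right (Nat.succ_le_of_lt hj))⟩

theorem enorm_rsSum_le (B : U →L[ℝ] V →L[ℝ] W) {f : ℝ → U} (g : ℝ → V)
    (D : TaggedPartition a b) {K : ℝ≥0∞} (hf : ∀ u ∈ Set.Icc a b, ‖f u‖ₑ ≤ K) {L : ℝ}
    (hL : b - a ≤ L) :
    ‖rsSum (fun v w => B v w) f g D‖ₑ ≤ ‖B‖ₑ * K * control 1 L (increments g) a b := by
  refine le_trans ?_ (mul_le_mul_right (varSum_le_control 1 (increments g) D.toPartition
    (D.mesh_le_length.trans hL)) _)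
  rw [varSum, Finset.mul_sum]
  refine (enorm_sum_le _ _).trans (Finset.sum_le_sum fun j hj => ?_)
  have hj := Finset.mem_range.1 hj
  rw [ENNReal.rpow_one, mul_assoc]
  refine (enorm_apply_apply_le B _ _).trans ?_
  gcongr
  · exact hf _ (D.tag_mem_Icc hj)
  · exact le_rfl

/-- Two Riemann sums are compared by writing both as double sums over pairs of cells of the two
partitions; the increments of `g` over the intersections of two cells add up to its increments over
each cell. -/
theorem enorm_rsSum_sub_rsSum_le (B : U →L[ℝ] V →L[ℝ] W) {f : ℝ → U} (g : ℝ → V)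
    (D D' : TaggedPartition a b) {L : ℝ} (hL : 0 < L) (hab : b - a ≤ L) {ε : ℝ≥0∞}
    (hf : ∀ x ∈ Set.Icc a b, ∀ y ∈ Set.Icc a b, |x - y| ≤ D.mesh + D'.mesh → ‖f x - f y‖ₑ ≤ ε) :
    ‖rsSum (fun v w => B v w) f g D - rsSum (fun v w => B v w) f g D'‖ₑ ≤
      ‖B‖ₑ * ε * control 1 L (increments g) a b := by
  set x : ℕ → ℕ → V := fun j k =>
    cellIncrement g (D.pt j) (D.pt (j + 1)) (D'.pt k) (D'.pt (k + 1)) with hx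
  have h1 : rsSum (fun v w => B v w) f g D =
      ∑ j ∈ Finset.range D.n, ∑ k ∈ Finset.range D'.n, B (f (D.tag j)) (x j k) := by
    refine Finset.sum_congr rfl fun j hj => ?_
    have hj := Finset.mem_range.1 hj
    rw [← map_sum, hx, sum_cellIncrement_right g D'.toPartition (D.left_le_pt hj.le)
      (D.lt_succ j hj).le (D.pt_le_right (Nat.succ_le_of_lt hj))]
  have h2 : rsSum (fun v w => B v w) f g D' =
      ∑ j ∈ Finset.range D.n, ∑ k ∈ Finset.range D'.n, B (f (D'.tag k)) (x j k) := by
    rw [Finset.sum_comm]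
    refine Finset.sum_congr rfl fun k hk => ?_
    have hk := Finset.mem_range.1 hk
    rw [← map_sum, hx, sum_cellIncrement_left g D.toPartition
      ⟨D'.left_le_pt hk.le, D'.pt_le_right hk.le⟩
      ⟨D'.left_le_pt (Nat.succ_le_of_lt hk), D'.pt_le_right (Nat.succ_le_of_lt hk)⟩]
  rw [h1, h2, ← Finset.sum_sub_distrib]
  refine le_trans ?_ (mul_le_mul_right
    (sum_sum_enorm_cellIncrement_le g D.toPartition D'.toPartition hL hab) _)
  rw [Finset.mul_sum]
  refine (enorm_sum_le _ _).trans (Finset.sum_le_sum fun j hj => ?_)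
  have hj := Finset.mem_range.1 hj
  rw [← Finset.sum_sub_distrib, Finset.mul_sum]
  refine (enorm_sum_le _ _).trans (Finset.sum_le_sum fun k hk => ?_)
  have hk := Finset.mem_range.1 hk
  -- Only overlapping cells contribute, and their representative points are close to each other.
  by_cases hlap : D.pt (j + 1) < D'.pt k ∨ D'.pt (k + 1) < D.pt j
  · have hx0 : x j k = 0 := cellIncrement_eq_zero g (D.lt_succ j hj).le (D'.lt_succ k hk).le hlap
    simp [hx0]
  · push Not at hlap
    rw [← sub_apply, ← map_sub, mul_assoc]
    refine (enorm_apply_apply_le B _ _).trans ?_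
    gcongr
    · refine hf _ (D.tag_mem_Icc hj) _ (D'.tag_mem_Icc hk) ?_
      have h3 := D.step_le_mesh hj
      have h4 := D'.step_le_mesh hk
      have h5 := D.tag_mem j hj
      have h6 := D'.tag_mem k hk
      rw [abs_le]
      constructor <;> linarith [h5.1, h5.2, h6.1, h6.2, hlap.1, hlap.2]

theorem exists_hasRSIntegral [CompleteSpace W] (B : U →L[ℝ] V →L[ℝ] W) {f : ℝ → U} {g : ℝ → V}
    {L : ℝ} (hL : 0 < L) (hab : a ≤ b) (hbL : b - a ≤ L) (hf : ContinuousOn f (Set.Icc a b))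
    (hg : control 1 L (increments g) a b < ∞) :
    ∃ I, HasRSIntegral (fun v w => B v w) f g a b I := by
  have := taggedMeshToZero_neBot hab
  refine cauchy_map_iff_exists_tendsto.1 (cauchy_map_iff.2 ⟨this, ?_⟩)
  refine uniformity_basis_edist_le.tendsto_right_iff.2 fun ε hε => ?_
  obtain ⟨η, hη, hlt⟩ := ENNReal.exists_nnreal_pos_mul_lt
    (ENNReal.mul_lt_top (enorm_lt_top (x := B)) hg).ne hε.ne'
  obtain ⟨δ, hδ, h⟩ := exists_modulus hf (ε := (η : ℝ≥0∞)) (by exact_mod_cast hη)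
  have hev : ∀ᶠ D in taggedMeshToZero a b, D.mesh ≤ δ / 2 :=
    eventually_taggedMeshToZero.2 ⟨δ / 2, half_pos hδ, fun _ hD => hD⟩
  filter_upwards [hev.prod_mk hev] with q hq
  rw [edist_eq_enorm_sub]
  refine (enorm_rsSum_sub_rsSum_le B g q.1 q.2 hL hbL
    fun x hx y hy hxy => h x hx y hy (by linarith [hq.1, hq.2])).trans (le_of_eq_of_le ?_ hlt.le)
  ring

theorem tendsto_concat : Tendsto
    (fun q : TaggedPartition a b × TaggedPartition b c => q.1.concat q.2)
    (taggedMeshToZero a b ×ˢ taggedMeshToZero b c) (taggedMeshToZero a c) := by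
  refine tendsto_comap_iff.2 ?_
  have h1 : Tendsto (fun D : TaggedPartition a b => D.mesh) (taggedMeshToZero a b) (𝓝 0) :=
    tendsto_comap
  have h2 : Tendsto (fun D : TaggedPartition b c => D.mesh) (taggedMeshToZero b c) (𝓝 0) :=
    tendsto_comap
  have h := (h1.comp tendsto_fst).add (h2.comp tendsto_snd)
  rw [add_zero] at h
  refine squeeze_zero (fun q => Partition.mesh_nonneg _) (fun q => ?_) h
  exact q.1.toPartition.mesh_concat_le q.2.toPartition
    (le_add_of_nonneg_right q.2.mesh_nonneg) (le_add_of_nonneg_left q.1.mesh_nonneg)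

theorem HasRSIntegral.eq_add (B : U →L[ℝ] V →L[ℝ] W) {f : ℝ → U} {g : ℝ → V} (hab : a ≤ b)
    (hbc : b ≤ c) {I J K : W} (hI : HasRSIntegral (fun v w => B v w) f g a b I)
    (hJ : HasRSIntegral (fun v w => B v w) f g b c J)
    (hK : HasRSIntegral (fun v w => B v w) f g a c K) : K = I + J := by
  have := taggedMeshToZero_neBot hab
  have := taggedMeshToZero_neBot hbc
  have h := (hI.comp tendsto_fst).add (hJ.comp tendsto_snd)
  refine tendsto_nhds_unique (hK.comp tendsto_concat) (h.congr fun q => ?_)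
  exact (rsSum_concat B f g q.1 q.2).symm

theorem HasRSIntegral.add_const (B : U →L[ℝ] V →L[ℝ] W) {f : ℝ → U} {g : ℝ → V} {I : W}
    (hI : HasRSIntegral (fun v w => B v w) f g a b I) (v : U) :
    HasRSIntegral (fun v w => B v w) (fun u => f u + v) g a b (I + B v (g b - g a)) := by
  refine (Tendsto.add_const (B v (g b - g a)) hI).congr fun D => ?_
  have h : g b - g a = ∑ j ∈ Finset.range D.n, (g (D.pt (j + 1)) - g (D.pt j)) := by
    rw [Finset.sum_range_sub (fun j => g (D.pt j)), D.pt_last, D.pt_zero]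
  rw [h, map_sum, rsSum, rsSum, ← Finset.sum_add_distrib]
  simp only [map_add, add_apply]

theorem HasRSIntegral.enorm_le (B : U →L[ℝ] V →L[ℝ] W) {f : ℝ → U} {g : ℝ → V} {I : W}
    (hab : a ≤ b) (hI : HasRSIntegral (fun v w => B v w) f g a b I) {K : ℝ≥0∞}
    (hf : ∀ u ∈ Set.Icc a b, ‖f u‖ₑ ≤ K) {L : ℝ} (hL : b - a ≤ L) :
    ‖I‖ₑ ≤ ‖B‖ₑ * K * control 1 L (increments g) a b :=
  have := taggedMeshToZero_neBot hab
  le_of_tendsto hI.enorm (Eventually.of_forall fun D => enorm_rsSum_le B g D hf hL)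

end RiemannStieltjes

/-! ### The area of a continuous path of bounded variation -/

/-- Chen's relation between a path `γ` and a function `α` on the triangle, relative to the bilinear
map `B`. -/
def IsChen {V W : Type*} [NormedAddCommGroup V] [NormedSpace ℝ V] [NormedAddCommGroup W]
    [NormedSpace ℝ W] (B : V →L[ℝ] V →L[ℝ] W) (T : ℝ) (γ : ℝ → V) (α : ℝ → ℝ → W) : Prop :=
  ∀ s t u, 0 ≤ s → s ≤ t → t ≤ u → u ≤ T →
    α s u = α s t + α t u + (1 / 2 : ℝ) • B (γ t - γ s) (γ u - γ t)

theorem IsChen.diag {V W : Type*} [NormedAddCommGroup V] [NormedSpace ℝ V] [NormedAddCommGroup W]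
    [NormedSpace ℝ W] {B : V →L[ℝ] V →L[ℝ] W} {T : ℝ} {γ : ℝ → V} {α : ℝ → ℝ → W}
    (h : IsChen B T γ α) {t : ℝ} (h0 : 0 ≤ t) (hT : t ≤ T) : α t t = 0 := by
  have := h t t t h0 le_rfl le_rfl hT
  simpa using this

section Area

variable {V W : Type*} [NormedAddCommGroup V] [NormedSpace ℝ V] [NormedAddCommGroup W]
  [NormedSpace ℝ W]

/-- The area `½ ∫_s^t B(γ(u) - γ(s), dγ(u))` of a path, relative to the bilinear map `B`. -/
def areaOf (B : V →L[ℝ] V →L[ℝ] W) (γ : ℝ → V) (s t : ℝ) : W :=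
  (1 / 2 : ℝ) • rsIntegral (fun v w => B v w) (fun u => γ u - γ s) γ s t

variable [CompleteSpace W] {B : V →L[ℝ] V →L[ℝ] W}

variable {T : ℝ} {γ : ℝ → V}

theorem IsFiniteVarPath.hasRSIntegral_area (hT : 0 < T) (hγ : IsFiniteVarPath 1 T γ) {s t : ℝ}
    (hs : 0 ≤ s) (hst : s ≤ t) (ht : t ≤ T) :
    HasRSIntegral (fun v w => B v w) (fun u => γ u - γ s) γ s t
      ((2 : ℝ) • areaOf B γ s t) := by
  have hV : control 1 T (increments γ) s t < ∞ :=
    ((isSuperadditive_control 1 hT _).mono hs hst ht).trans_lt hγ.control_lt_top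
  have hf : ContinuousOn (fun u => γ u - γ s) (Set.Icc s t) :=
    (hγ.1.mono (Set.Icc_subset_Icc hs ht)).sub continuousOn_const
  obtain ⟨I, hI⟩ := exists_hasRSIntegral (B) hT hst (by linarith) hf hV
  have h : areaOf B γ s t = (1 / 2 : ℝ) • I := by
    rw [areaOf]
    congr 1
    exact hI.rsIntegral_eq hst
  rw [h, smul_smul]
  norm_num
  exact hI

theorem IsFiniteVarPath.isChen_area (hT : 0 < T) (hγ : IsFiniteVarPath 1 T γ) :
    IsChen (B) T γ (areaOf B γ) := by
  intro s t u hs hst htu hu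
  have h1 := hγ.hasRSIntegral_area (B := B) hT hs hst (htu.trans hu)
  have h2 := (hγ.hasRSIntegral_area (B := B) hT (hs.trans hst) htu hu).add_const
    B (γ t - γ s)
  have h3 := hγ.hasRSIntegral_area (B := B) hT hs (hst.trans htu) hu
  simp only [sub_add_sub_cancel] at h2
  have h4 := HasRSIntegral.eq_add (B) hst htu h1 h2 h3
  have h5 := congrArg (fun x => (1 / 2 : ℝ) • x) h4
  simp only [smul_add, smul_smul] at h5
  norm_num at h5
  rw [h5]
  norm_num
  abel

theorem IsFiniteVarPath.enorm_area_le (hT : 0 < T) (hγ : IsFiniteVarPath 1 T γ) {s t : ℝ}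
    (hs : 0 ≤ s) (hst : s ≤ t) (ht : t ≤ T) {K : ℝ≥0∞}
    (hK : ∀ u ∈ Set.Icc s t, ‖γ u - γ s‖ₑ ≤ K) :
    ‖areaOf B γ s t‖ₑ ≤ ‖B‖ₑ * K * control 1 T (increments γ) s t := by
  refine le_trans ?_ ((hγ.hasRSIntegral_area (B := B) hT hs hst ht).enorm_le (B) hst hK
    (by linarith))
  rw [two_smul, ← ofReal_norm, ← ofReal_norm]
  refine ENNReal.ofReal_le_ofReal ?_
  rw [← two_smul ℝ, norm_smul]
  norm_num
  linarith [norm_nonneg (areaOf B γ s t)]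

/-- The area of a continuous path of bounded variation is of vanishing `1`-variation: on intervals
of length at most `δ` it is bounded by the modulus of continuity of the path times its variation. -/
theorem IsFiniteVarPath.exists_control_area_le (hT : 0 < T) (hγ : IsFiniteVarPath 1 T γ)
    {ε : ℝ≥0∞} (hε : 0 < ε) : ∃ δ > 0, control 1 δ (areaOf B γ) 0 T ≤ ε := by
  obtain ⟨η, hη, hlt⟩ := ENNReal.exists_nnreal_pos_mul_lt
    (ENNReal.mul_lt_top (enorm_lt_top (x := B)) hγ.control_lt_top).ne hε.ne'
  obtain ⟨δ, hδ, h⟩ := exists_modulus hγ.1 (ε := (η : ℝ≥0∞)) (by exact_mod_cast hη)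
  refine ⟨δ, hδ, (control_le_of_forall_le ((isSuperadditive_control 1 hT
    (increments γ)).const_mul (‖B‖ₑ * η)) fun s t hs hst ht hd => ?_).trans ?_⟩
  · rw [ENNReal.rpow_one]
    refine hγ.enorm_area_le hT hs hst ht fun u hu => ?_
    refine h u ⟨hs.trans hu.1, hu.2.trans ht⟩ s ⟨hs, hst.trans ht⟩ ?_
    rw [abs_of_nonneg (sub_nonneg.2 hu.1)]
    linarith [hu.2]
  · refine le_of_eq_of_le ?_ hlt.le
    ring

end Area

/-! ### The bracket -/

section Bracket

/-- The bounded bilinear maps `V × V → W`. The abbreviation makes Lean find the algebraic structure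
on `W` through its norm, as the lemmas on `areaOf` do; for `W = [V, V]` the structure found directly
agrees with it only after unfolding the completion. -/
abbrev BoundedBilinearMap (V W : Type*) [NormedAddCommGroup V] [NormedSpace ℝ V] [NormedAddCommGroup W]
    [NormedSpace ℝ W] := V →L[ℝ] V →L[ℝ] W

variable {V : Type*} [NormedAddCommGroup V] [NormedSpace ℝ V] (N : TensorNorm V)

theorem norm_bracket_le (v w : V) : ‖bracket N v w‖ ≤ 2 * ‖v‖ * ‖w‖ := by
  have h : ‖bracket N v w‖ = N.toSeminorm (v ⊗ₜ[ℝ] w - w ⊗ₜ[ℝ] v) :=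
    UniformSpace.Completion.norm_coe (algBracket N v w)
  rw [h]
  have h1 := map_sub_le_add N.toSeminorm (v ⊗ₜ[ℝ] w) (w ⊗ₜ[ℝ] v)
  linarith [N.tmul_le v w, N.tmul_le w v]

/-- The bracket `(v, w) ↦ [v, w]` as a bounded bilinear map. -/
def bracketL : BoundedBilinearMap V (lieSquare N) :=
  LinearMap.mkContinuous₂
    (LinearMap.mk₂ ℝ (bracket N)
      (fun v v' w => Subtype.ext <| by
        change ((algBracket N (v + v') w : AlgTensor N) : BanachTensor N) =
          (algBracket N v w : BanachTensor N) + (algBracket N v' w : BanachTensor N)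
        rw [← UniformSpace.Completion.coe_add]
        congr 1
        change (_ : V ⊗[ℝ] V) = _
        simp only [algBracket, TensorProduct.add_tmul, TensorProduct.tmul_add]
        exact add_sub_add_comm _ _ _ _)
      (fun c v w => Subtype.ext <| by
        change ((algBracket N (c • v) w : AlgTensor N) : BanachTensor N) =
          c • (algBracket N v w : BanachTensor N)
        rw [← UniformSpace.Completion.coe_smul]
        congr 1
        change ((c • v) ⊗ₜ[ℝ] w - w ⊗ₜ[ℝ] (c • v) : V ⊗[ℝ] V) = c • (v ⊗ₜ[ℝ] w - w ⊗ₜ[ℝ] v)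
        rw [smul_sub, TensorProduct.smul_tmul', TensorProduct.tmul_smul])
      (fun v w w' => Subtype.ext <| by
        change ((algBracket N v (w + w') : AlgTensor N) : BanachTensor N) =
          (algBracket N v w : BanachTensor N) + (algBracket N v w' : BanachTensor N)
        rw [← UniformSpace.Completion.coe_add]
        congr 1
        change (_ : V ⊗[ℝ] V) = _
        simp only [algBracket, TensorProduct.add_tmul, TensorProduct.tmul_add]
        exact add_sub_add_comm _ _ _ _)
      (fun c v w => Subtype.ext <| by
        change ((algBracket N v (c • w) : AlgTensor N) : BanachTensor N) =
          c • (algBracket N v w : BanachTensor N)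
        rw [← UniformSpace.Completion.coe_smul]
        congr 1
        change (v ⊗ₜ[ℝ] (c • w) - (c • w) ⊗ₜ[ℝ] v : V ⊗[ℝ] V) = c • (v ⊗ₜ[ℝ] w - w ⊗ₜ[ℝ] v)
        rw [smul_sub, TensorProduct.tmul_smul, ← TensorProduct.smul_tmul' c w v]))
    2 (norm_bracket_le N)

instance : CompleteSpace (lieSquare N) :=
  (Submodule.isClosed_topologicalClosure _).completeSpace_coe

end Bracket

/-! ### Piecewise linear interpolation -/

section Interp

variable {V : Type*} [NormedAddCommGroup V] {a b : ℝ}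

/-- The position of `t` relative to the cell `[t_j, t_{j+1}]`: it increases linearly from `0` to `1`
on the cell and is constant on either side of it. -/
def Partition.weight (D : Partition a b) (j : ℕ) (t : ℝ) : ℝ :=
  max 0 (min 1 ((t - D.pt j) / (D.pt (j + 1) - D.pt j)))

theorem Partition.monotone_weight (D : Partition a b) {j : ℕ} (hj : j < D.n) :
    Monotone (D.weight j) := fun x y hxy => by
  have := sub_pos.2 (D.lt_succ j hj)
  unfold Partition.weight
  gcongr

theorem Partition.weight_sub_le_one (D : Partition a b) (j : ℕ) (s t : ℝ) :
    D.weight j t - D.weight j s ≤ 1 := by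
  have h1 : D.weight j t ≤ 1 := max_le zero_le_one (min_le_left _ _)
  have h2 : 0 ≤ D.weight j s := le_max_left _ _
  linarith

theorem Partition.weight_of_mem (D : Partition a b) {k : ℕ} (hk : k < D.n) {t : ℝ}
    (h1 : D.pt k ≤ t) (h2 : t ≤ D.pt (k + 1)) :
    D.weight k t = (t - D.pt k) / (D.pt (k + 1) - D.pt k) := by
  have := sub_pos.2 (D.lt_succ k hk)
  rw [Partition.weight, min_eq_right, max_eq_right]
  · exact div_nonneg (by linarith) this.le
  · rw [div_le_one this]; linarith

/-- The function `(s, t) ↦ ∑_j (λ_j(t) - λ_j(s)) ‖γ(t_{j+1}) - γ(t_j)‖²`, which is superadditive and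
dominates the squared increments of `γ^D` over subintervals of cells. -/
def Partition.interpControl (D : Partition a b) (γ : ℝ → V) (s t : ℝ) : ℝ≥0∞ :=
  ∑ j ∈ Finset.range D.n,
    ‖γ (D.pt (j + 1)) - γ (D.pt j)‖ₑ ^ 2 * ENNReal.ofReal (D.weight j t - D.weight j s)

theorem Partition.isSuperadditive_interpControl (D : Partition a b) (γ : ℝ → V) :
    IsSuperadditive (D.interpControl γ) :=
  IsSuperadditive.sum _ fun _ hj =>
    (IsSuperadditive.of_monotone (D.monotone_weight (Finset.mem_range.1 hj))).const_mul _

theorem Partition.interpControl_le (D : Partition a b) (γ : ℝ → V) {δ : ℝ} (hD : D.mesh ≤ δ)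
    (s t : ℝ) : D.interpControl γ s t ≤ control 2 δ (increments γ) a b := by
  refine le_trans (Finset.sum_le_sum fun j _ => ?_) (varSum_le_control 2 (increments γ) D hD)
  rw [ENNReal.rpow_two]
  calc ‖γ (D.pt (j + 1)) - γ (D.pt j)‖ₑ ^ 2 * ENNReal.ofReal (D.weight j t - D.weight j s)
      ≤ ‖γ (D.pt (j + 1)) - γ (D.pt j)‖ₑ ^ 2 * 1 := by
        gcongr
        exact ENNReal.ofReal_le_one.2 (D.weight_sub_le_one j s t)
    _ = _ := mul_one _

variable [NormedSpace ℝ V]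

theorem Partition.interp_sub (D : Partition a b) (γ : ℝ → V) (s t : ℝ) :
    D.interp γ t - D.interp γ s = ∑ j ∈ Finset.range D.n,
      (D.weight j t - D.weight j s) • (γ (D.pt (j + 1)) - γ (D.pt j)) := by
  simp only [sub_smul, Finset.sum_sub_distrib]
  exact add_sub_add_left_eq_sub _ _ _

/-- Inside a cell the interpolation is linear. -/
theorem Partition.interp_sub_of_mem (D : Partition a b) (γ : ℝ → V) {k : ℕ} (hk : k < D.n)
    {s t : ℝ} (hs : s ∈ Set.Icc (D.pt k) (D.pt (k + 1)))
    (ht : t ∈ Set.Icc (D.pt k) (D.pt (k + 1))) :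
    D.interp γ t - D.interp γ s =
      (D.weight k t - D.weight k s) • (γ (D.pt (k + 1)) - γ (D.pt k)) := by
  have h := sub_pos.2 (D.lt_succ k hk)
  have h' := h.ne'
  rw [D.interp_eq γ hk hs, D.interp_eq γ hk ht, D.weight_of_mem hk hs.1 hs.2,
    D.weight_of_mem hk ht.1 ht.2]
  have hc : ∀ x, (D.pt (k + 1) - x) / (D.pt (k + 1) - D.pt k) =
      1 - (x - D.pt k) / (D.pt (k + 1) - D.pt k) := fun x => by field_simp; ring
  rw [hc, hc]
  module

theorem Partition.interp_pt (D : Partition a b) (γ : ℝ → V) {k : ℕ} (hk : k ≤ D.n) :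
    D.interp γ (D.pt k) = γ (D.pt k) := by
  rcases hk.lt_or_eq with h | h
  · have h1 := sub_pos.2 (D.lt_succ k h)
    rw [D.interp_eq γ h ⟨le_rfl, (D.lt_succ k h).le⟩, sub_self, zero_div, zero_smul, zero_add,
      div_self h1.ne', one_smul]
  · rcases Nat.eq_zero_or_pos k with h0 | h0
    · subst h0
      rw [Partition.interp, ← h]
      simp
    · obtain ⟨m, rfl⟩ := Nat.exists_eq_succ_of_ne_zero h0.ne'
      have hm : m < D.n := by omega
      have h1 := sub_pos.2 (D.lt_succ m hm)
      rw [Nat.succ_eq_add_one, D.interp_eq γ hm ⟨(D.lt_succ m hm).le, le_rfl⟩, sub_self, zero_div,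
        zero_smul, add_zero, div_self h1.ne', one_smul]

/-- The piecewise linear interpolation is a continuous path of bounded variation. -/
theorem Partition.isFiniteVarPath_interp {T : ℝ} (D : Partition 0 T) (γ : ℝ → V) :
    IsFiniteVarPath 1 T (D.interp γ) := by
  constructor
  · unfold Partition.interp
    fun_prop
  · have hw : IsSuperadditive fun s t => ∑ j ∈ Finset.range D.n,
        ‖γ (D.pt (j + 1)) - γ (D.pt j)‖ₑ * ENNReal.ofReal (D.weight j t - D.weight j s) :=
      IsSuperadditive.sum _ fun j hj =>
        (IsSuperadditive.of_monotone (D.monotone_weight (Finset.mem_range.1 hj))).const_mul _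
    rw [pVar_eq, div_one, ENNReal.rpow_one]
    refine (control_le_of_forall_le hw fun s t _ hst _ _ => ?_).trans_lt
      (ENNReal.sum_lt_top.2 fun j _ => ENNReal.mul_lt_top enorm_lt_top ENNReal.ofReal_lt_top)
    rw [ENNReal.rpow_one, increments, D.interp_sub]
    refine (enorm_sum_le _ _).trans (Finset.sum_le_sum fun j hj => ?_)
    rw [enorm_smul, mul_comm, Real.enorm_of_nonneg
      (sub_nonneg.2 (D.monotone_weight (Finset.mem_range.1 hj) hst))]

theorem Partition.enorm_interp_sub_sq_le (D : Partition a b) (γ : ℝ → V) {k : ℕ} (hk : k < D.n)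
    {s t : ℝ} (hs : D.pt k ≤ s) (hst : s ≤ t) (ht : t ≤ D.pt (k + 1)) :
    ‖D.interp γ t - D.interp γ s‖ₑ ^ 2 ≤ D.interpControl γ s t := by
  refine le_trans ?_ (Finset.single_le_sum (f := fun j =>
    ‖γ (D.pt (j + 1)) - γ (D.pt j)‖ₑ ^ 2 * ENNReal.ofReal (D.weight j t - D.weight j s))
    (fun _ _ => zero_le) (Finset.mem_range.2 hk))
  have h0 := sub_nonneg.2 (D.monotone_weight hk hst)
  rw [D.interp_sub_of_mem γ hk ⟨hs, hst.trans ht⟩ ⟨hs.trans hst, ht⟩, enorm_smul, mul_pow,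
    Real.enorm_of_nonneg h0, mul_comm]
  gcongr
  -- The weight increment lies in `[0, 1]`, so it dominates its square.
  rw [← ENNReal.ofReal_pow h0]
  refine ENNReal.ofReal_le_ofReal ?_
  have h1 := D.weight_sub_le_one k s t
  nlinarith

theorem add_sq_le_two_mul (x y : ℝ≥0∞) : (x + y) ^ 2 ≤ 2 * (x ^ 2 + y ^ 2) := by
  have := ENNReal.rpow_add_le_mul_rpow_add_rpow x y (one_le_two (α := ℝ))
  norm_num at this
  exact this

/-- Piecewise linear interpolations of a path of vanishing `2`-variation converge to it in
`2`-variation. An interval that is not contained in one cell is cut at its first and last partition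
points; the interpolation error has the same increment over it as over the two outer pieces. -/
theorem Partition.control_sub_interp_le {T : ℝ} (hT : 0 < T) (γ : ℝ → V) (D : Partition 0 T)
    {δ : ℝ} (hδ : 0 < δ) (hD : D.mesh ≤ δ) :
    control 2 T (increments fun t => γ t - D.interp γ t) 0 T ≤
      8 * control 2 δ (increments γ) 0 T := by
  set g := control 2 δ (increments γ) with hg
  set h := D.interpControl γ with hh
  have hgs : IsSuperadditive g := isSuperadditive_control 2 hδ _
  have hhs : IsSuperadditive h := D.isSuperadditive_interpControl γ
  have hw : IsSuperadditive fun s t => g s t + h s t := hgs.add hhs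
  have hcell : ∀ k < D.n, ∀ s t, D.pt k ≤ s → s ≤ t → t ≤ D.pt (k + 1) →
      ‖(γ t - D.interp γ t) - (γ s - D.interp γ s)‖ₑ ^ 2 ≤ 2 * (g s t + h s t) := by
    intro k hk s t hs hst ht
    have h1 := D.step_le_mesh hk
    rw [sub_sub_sub_comm]
    calc ‖(γ t - γ s) - (D.interp γ t - D.interp γ s)‖ₑ ^ 2
        ≤ (‖γ t - γ s‖ₑ + ‖D.interp γ t - D.interp γ s‖ₑ) ^ 2 := by
          gcongr
          exact enorm_sub_le
      _ ≤ 2 * (‖γ t - γ s‖ₑ ^ 2 + ‖D.interp γ t - D.interp γ s‖ₑ ^ 2) := add_sq_le_two_mul _ _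
      _ ≤ 2 * (g s t + h s t) := by
          gcongr
          · exact enorm_increments_sq_le_control γ hst (by linarith)
          · exact D.enorm_interp_sub_sq_le γ hk hs hst ht
  refine (control_le_of_forall_le (hw.const_mul 4) fun s t hs hst ht _ => ?_).trans ?_
  · rw [ENNReal.rpow_two, increments]
    rcases D.exists_cells hT hs hst ht with ⟨k, hk, hks, hkt⟩ | ⟨k, l, hkl, hl, hks, hlt⟩
    · refine (hcell k hk s t hks hst hkt).trans ?_
      gcongr
      norm_num
    · have hpk := D.interp_pt γ (show k + 1 ≤ D.n by omega)
      have hpl := D.interp_pt γ hl.le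
      have hkl' := D.pt_le (show k + 1 ≤ l by omega) hl.le
      have hsplit : (γ t - D.interp γ t) - (γ s - D.interp γ s) =
          ((γ t - D.interp γ t) - (γ (D.pt l) - D.interp γ (D.pt l))) +
            ((γ (D.pt (k + 1)) - D.interp γ (D.pt (k + 1))) - (γ s - D.interp γ s)) := by
        rw [hpk, hpl]
        abel
      rw [hsplit]
      calc _ ≤ (‖(γ t - D.interp γ t) - (γ (D.pt l) - D.interp γ (D.pt l))‖ₑ +
            ‖(γ (D.pt (k + 1)) - D.interp γ (D.pt (k + 1))) - (γ s - D.interp γ s)‖ₑ) ^ 2 := by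
            gcongr
            exact enorm_add_le _ _
        _ ≤ 2 * (2 * (g (D.pt l) t + h (D.pt l) t) +
            2 * (g s (D.pt (k + 1)) + h s (D.pt (k + 1)))) := by
            refine (add_sq_le_two_mul _ _).trans ?_
            gcongr
            · exact hcell l hl _ _ le_rfl hlt.1 hlt.2
            · exact hcell k (by omega) _ _ hks.1 hks.2 le_rfl
        _ = 4 * ((g s (D.pt (k + 1)) + h s (D.pt (k + 1))) + (g (D.pt l) t + h (D.pt l) t)) := by
            ring
        _ ≤ 4 * ((g s (D.pt (k + 1)) + h s (D.pt (k + 1))) +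
              (g (D.pt (k + 1)) t + h (D.pt (k + 1)) t)) := by
            have := hw.mono hkl' hlt.1 le_rfl
            gcongr
        _ ≤ 4 * (g s t + h s t) := by
            have := hw s (D.pt (k + 1)) t hks.2 (hkl'.trans hlt.1)
            gcongr
  · calc 4 * (g 0 T + h 0 T) ≤ 4 * (g 0 T + g 0 T) := by
          gcongr
          exact D.interpControl_le γ hD 0 T
      _ = 8 * g 0 T := by ring

end Interp

/-! ### Convergence of the areas of piecewise linear interpolations -/

section Convergence

variable {V W : Type*} [NormedAddCommGroup V] [NormedSpace ℝ V] [NormedAddCommGroup W]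
  [NormedSpace ℝ W] {B : V →L[ℝ] V →L[ℝ] W} {T : ℝ} {γ : ℝ → V} {α : ℝ → ℝ → W}

/-- The area of a piecewise linear path vanishes inside the cells. -/
theorem Partition.areaOf_interp_eq_zero {a b : ℝ} (hB : ∀ v, B v v = 0) (D : Partition a b)
    (γ : ℝ → V) {k : ℕ} (hk : k < D.n) {s t : ℝ} (hs : D.pt k ≤ s) (hst : s ≤ t)
    (ht : t ≤ D.pt (k + 1)) : areaOf B (D.interp γ) s t = 0 := by
  have h : HasRSIntegral (fun v w => B v w) (fun u => D.interp γ u - D.interp γ s) (D.interp γ)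
      s t 0 := by
    refine tendsto_const_nhds.congr fun D' => ?_
    refine (Finset.sum_eq_zero fun j hj => ?_).symm
    have hj := Finset.mem_range.1 hj
    have hmem : ∀ u ∈ Set.Icc s t, u ∈ Set.Icc (D.pt k) (D.pt (k + 1)) := fun u hu =>
      ⟨hs.trans hu.1, hu.2.trans ht⟩
    dsimp only
    rw [D.interp_sub_of_mem γ hk (hmem s ⟨le_rfl, hst⟩) (hmem _ (D'.tag_mem_Icc hj)),
      D.interp_sub_of_mem γ hk (hmem _ ⟨D'.left_le_pt hj.le, D'.pt_le_right hj.le⟩)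
        (hmem _ ⟨D'.left_le_pt (Nat.succ_le_of_lt hj), D'.pt_le_right (Nat.succ_le_of_lt hj)⟩)]
    simp only [map_smul, smul_apply, hB, smul_zero]
  rw [areaOf, h.rsIntegral_eq hst, smul_zero]

theorem mul_le_mul_sq_add_inv_mul_sq (x y : ℝ≥0∞) {l : ℝ≥0∞} (h0 : l ≠ 0) (h1 : l ≠ ∞) :
    x * y ≤ l * x ^ 2 + l⁻¹ * y ^ 2 := by
  rcases le_total y (l * x) with h | h
  · calc x * y ≤ x * (l * x) := by gcongr
      _ = l * x ^ 2 := by ring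
      _ ≤ _ := le_self_add
  · calc x * y = (l⁻¹ * (l * x)) * y := by
          rw [← mul_assoc, ENNReal.inv_mul_cancel h0 h1, one_mul]
      _ ≤ (l⁻¹ * y) * y := by gcongr
      _ = l⁻¹ * y ^ 2 := by ring
      _ ≤ _ := le_add_self

theorem enorm_half_smul_le (B : V →L[ℝ] V →L[ℝ] W) (v w : V) {x y K : ℝ≥0∞} (hv : ‖v‖ₑ ≤ x)
    (hw : ‖w‖ₑ ≤ y) (hK : x * y ≤ K) : ‖(1 / 2 : ℝ) • B v w‖ₑ ≤ ‖B‖ₑ * K := by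
  calc ‖(1 / 2 : ℝ) • B v w‖ₑ ≤ ‖B v w‖ₑ := by
        rw [enorm_smul]
        refine mul_le_of_le_one_left' ?_
        rw [Real.enorm_of_nonneg (by norm_num)]
        exact ENNReal.ofReal_le_one.2 (by norm_num)
    _ ≤ ‖B‖ₑ * (‖v‖ₑ * ‖w‖ₑ) := enorm_apply_apply_le B v w
    _ ≤ ‖B‖ₑ * K := by
        gcongr
        exact (mul_le_mul' hv hw).trans hK

/-- Between two points of `D`, the difference `α - A(γ^D)` is the sum of `α` over the cells. -/
theorem IsChen.enorm_sub_interp_le_control (hα : IsChen B T γ α) (D : Partition 0 T)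
    {A : ℝ → ℝ → W} (hA : IsChen B T (D.interp γ) A)
    (hA0 : ∀ k < D.n, ∀ s t, D.pt k ≤ s → s ≤ t → t ≤ D.pt (k + 1) → A s t = 0) {δ : ℝ}
    (hδ : 0 < δ) (hD : D.mesh ≤ δ) {k l : ℕ} (hkl : k ≤ l) (hl : l ≤ D.n) :
    ‖α (D.pt k) (D.pt l) - A (D.pt k) (D.pt l)‖ₑ ≤ control 1 δ α (D.pt k) (D.pt l) := by
  induction l, hkl using Nat.le_induction with
  | base =>
    have h0 := D.left_le_pt hl
    have h1 := D.pt_le_right hl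
    rw [hα.diag h0 h1, hA.diag h0 h1]
    simp
  | succ l hkl ih =>
    have hl' : l < D.n := by omega
    have h1 := D.lt_succ l hl'
    have h2 := D.pt_le hkl hl'.le
    have hk0 := D.left_le_pt (hkl.trans hl'.le)
    rw [hα _ _ _ hk0 h2 h1.le (D.pt_le_right hl), hA _ _ _ hk0 h2 h1.le (D.pt_le_right hl),
      D.interp_pt γ hl, D.interp_pt γ hl'.le, D.interp_pt γ (hkl.trans hl'.le),
      hA0 l hl' _ _ le_rfl h1.le le_rfl, add_zero, add_sub_add_right_eq_sub, add_sub_right_comm]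
    refine (enorm_add_le _ _).trans (le_trans ?_
      (isSuperadditive_control 1 hδ α _ _ _ h2 h1.le))
    gcongr
    · exact ih hl'.le
    · simpa using enorm_rpow_le_control 1 α h1 ((D.step_le_mesh hl').trans hD)

/-- The superadditive function that bounds `α - A(γ^D)`: with `g` and `h` controlling the squared
increments of `γ` and of `γ^D` over short intervals and `G` those of `γ` over all intervals, each
cross term in Chen's relation is a product of a short increment and an arbitrary one, and is bounded
by `l (g + h) + l⁻¹ (G + h)`. -/
theorem IsChen.enorm_sub_areaOf_interp_le [CompleteSpace W] (hB : ∀ v, B v v = 0) (hT : 0 < T)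
    (hα : IsChen B T γ α) (D : Partition 0 T) {δ : ℝ} (hδ : 0 < δ) (hD : D.mesh ≤ δ)
    {l : ℝ≥0∞} (hl0 : l ≠ 0) (hl1 : l ≠ ∞) {s t : ℝ} (hs : 0 ≤ s) (hst : s ≤ t) (ht : t ≤ T) :
    ‖α s t - areaOf B (D.interp γ) s t‖ₑ ≤ control 1 δ α s t +
      5 * ‖B‖ₑ * (l * (control 2 δ (increments γ) s t + D.interpControl γ s t) +
        l⁻¹ * (control 2 T (increments γ) s t + D.interpControl γ s t)) := by
  set A := areaOf B (D.interp γ)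
  have hA : IsChen B T (D.interp γ) A := (D.isFiniteVarPath_interp γ).isChen_area hT
  have hA0 : ∀ k < D.n, ∀ s t, D.pt k ≤ s → s ≤ t → t ≤ D.pt (k + 1) → A s t = 0 :=
    fun k hk s t hs hst ht => D.areaOf_interp_eq_zero hB γ hk hs hst ht
  have hshort : ∀ k < D.n, ∀ s t, D.pt k ≤ s → s ≤ t → t ≤ D.pt (k + 1) →
      ‖α s t - A s t‖ₑ ≤ control 1 δ α s t := by
    intro k hk s t hs hst ht
    rw [hA0 k hk s t hs hst ht, sub_zero]
    rcases hst.eq_or_lt with rfl | hst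
    · rw [hα.diag ((D.left_le_pt hk.le).trans hs)
        (ht.trans (D.pt_le_right (Nat.succ_le_of_lt hk)))]
      simp
    · have := D.step_le_mesh hk
      simpa using enorm_rpow_le_control 1 α hst (by linarith)
  rcases D.exists_cells hT hs hst ht with ⟨k, hk, hks, hkt⟩ | ⟨k, m, hkm, hm, hks, hmt⟩
  · exact (hshort k hk s t hks hst hkt).trans le_self_add
  have hk : k < D.n := hkm.trans hm
  have hkm' := D.pt_le (show k + 1 ≤ m by omega) hm.le
  have hpk := D.interp_pt γ (show k + 1 ≤ D.n by omega)
  have hpm := D.interp_pt γ hm.le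
  have hsk := D.step_le_mesh hk
  have hsm := D.step_le_mesh hm
  set s' := D.pt (k + 1)
  set t' := D.pt m
  set K := l * (control 2 δ (increments γ) s t + D.interpControl γ s t) +
        l⁻¹ * (control 2 T (increments γ) s t + D.interpControl γ s t) with hK
  -- Any product of a short increment and an arbitrary one is at most `K`.
  have hprod : ∀ x y : ℝ≥0∞,
      (x ^ 2 ≤ control 2 δ (increments γ) s t ∨ x ^ 2 ≤ D.interpControl γ s t) →
      (y ^ 2 ≤ control 2 T (increments γ) s t ∨ y ^ 2 ≤ D.interpControl γ s t) →
      x * y ≤ K := by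
    intro x y hx hy
    refine (mul_le_mul_sq_add_inv_mul_sq x y hl0 hl1).trans ?_
    rw [hK]
    gcongr
    · exact hx.elim (fun h => h.trans le_self_add) fun h => h.trans le_add_self
    · exact hy.elim (fun h => h.trans le_self_add) fun h => h.trans le_add_self
  have hP : ‖γ s' - γ s‖ₑ ^ 2 ≤ control 2 δ (increments γ) s t :=
    (enorm_increments_sq_le_control γ hks.2 (by linarith [hks.1])).trans
      ((isSuperadditive_control 2 hδ _).mono le_rfl hks.2 (hkm'.trans hmt.1))
  have hP' : ‖γ t - γ t'‖ₑ ^ 2 ≤ control 2 δ (increments γ) s t :=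
    (enorm_increments_sq_le_control γ hmt.1 (by linarith [hmt.2])).trans
      ((isSuperadditive_control 2 hδ _).mono (hks.2.trans hkm') hmt.1 le_rfl)
  have hR : ‖γ t' - γ s'‖ₑ ^ 2 ≤ control 2 T (increments γ) s t :=
    (enorm_increments_sq_le_control γ hkm' (by linarith [hks.2, hmt.1])).trans
      ((isSuperadditive_control 2 hT _).mono hks.2 hkm' hmt.1)
  have hS : ‖γ t - γ s'‖ₑ ^ 2 ≤ control 2 T (increments γ) s t :=
    (enorm_increments_sq_le_control γ (hkm'.trans hmt.1) (by linarith [hks.2])).trans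
      ((isSuperadditive_control 2 hT _).mono hks.2 (hkm'.trans hmt.1) le_rfl)
  have hQ : ‖D.interp γ s' - D.interp γ s‖ₑ ^ 2 ≤ D.interpControl γ s t :=
    (D.enorm_interp_sub_sq_le γ hk hks.1 hks.2 le_rfl).trans
      ((D.isSuperadditive_interpControl γ).mono le_rfl hks.2 (hkm'.trans hmt.1))
  have hQ' : ‖D.interp γ t - D.interp γ t'‖ₑ ^ 2 ≤ D.interpControl γ s t :=
    (D.enorm_interp_sub_sq_le γ hm le_rfl hmt.1 hmt.2).trans
      ((D.isSuperadditive_interpControl γ).mono (hks.2.trans hkm') hmt.1 le_rfl)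
  -- Chen's relation at `s'` and `t'`, for `α` and for the area of `γ^D`.
  have hsplit : α s t - A s t =
      ((α s s' - A s s') + (α s' t' - A s' t') + (α t' t - A t' t)) +
      ((1 / 2 : ℝ) • B (γ s' - γ s) (γ t - γ s') + (1 / 2 : ℝ) • B (γ t' - γ s') (γ t - γ t') -
        (1 / 2 : ℝ) • B (D.interp γ s' - D.interp γ s) (γ t' - γ s') -
        (1 / 2 : ℝ) • B (D.interp γ s' - D.interp γ s) (D.interp γ t - D.interp γ t') -
        (1 / 2 : ℝ) • B (γ t' - γ s') (D.interp γ t - D.interp γ t')) := by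
    have h1 : D.interp γ t - D.interp γ s' =
        (γ t' - γ s') + (D.interp γ t - D.interp γ t') := by
      rw [hpk, hpm]; abel
    rw [hα s s' t hs hks.2 (hkm'.trans hmt.1) ht, hA s s' t hs hks.2 (hkm'.trans hmt.1) ht,
      hα s' t' t (hs.trans hks.2) hkm' hmt.1 ht, hA s' t' t (hs.trans hks.2) hkm' hmt.1 ht, h1,
      map_add, smul_add, hpk, hpm]
    abel
  have hmain : ‖(α s s' - A s s') + (α s' t' - A s' t') + (α t' t - A t' t)‖ₑ ≤
      control 1 δ α s t := by
    have hsup := isSuperadditive_control 1 hδ α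
    refine ((enorm_add_le _ _).trans (add_le_add_left (enorm_add_le _ _) _)).trans ?_
    calc _ ≤ control 1 δ α s s' + control 1 δ α s' t' + control 1 δ α t' t := by
          gcongr
          · exact hshort k hk s s' hks.1 hks.2 le_rfl
          · exact hα.enorm_sub_interp_le_control D hA hA0 hδ hD (by omega) hm.le
          · exact hshort m hm t' t le_rfl hmt.1 hmt.2
      _ ≤ control 1 δ α s t' + control 1 δ α t' t := by
          gcongr
          exact hsup _ _ _ hks.2 hkm'
      _ ≤ control 1 δ α s t := hsup _ _ _ (hks.2.trans hkm') hmt.1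
  have hc1 := enorm_half_smul_le B _ _ le_rfl le_rfl (hprod _ _ (Or.inl hP) (Or.inl hS))
  have hc2 : ‖(1 / 2 : ℝ) • B (γ t' - γ s') (γ t - γ t')‖ₑ ≤ ‖B‖ₑ * K :=
    enorm_half_smul_le B _ _ le_rfl le_rfl
      ((mul_comm _ _).trans_le (hprod _ _ (Or.inl hP') (Or.inl hR)))
  have hc3 := enorm_half_smul_le B _ _ le_rfl le_rfl (hprod _ _ (Or.inr hQ) (Or.inl hR))
  have hc4 := enorm_half_smul_le B _ _ le_rfl le_rfl (hprod _ _ (Or.inr hQ) (Or.inr hQ'))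
  have hc5 : ‖(1 / 2 : ℝ) • B (γ t' - γ s') (D.interp γ t - D.interp γ t')‖ₑ ≤ ‖B‖ₑ * K :=
    enorm_half_smul_le B _ _ le_rfl le_rfl
      ((mul_comm _ _).trans_le (hprod _ _ (Or.inr hQ') (Or.inl hR)))
  rw [hsplit]
  refine (enorm_add_le _ _).trans (add_le_add hmain ?_)
  refine le_trans (enorm_sub_le.trans (add_le_add (enorm_sub_le.trans (add_le_add
    (enorm_sub_le.trans (add_le_add ((enorm_add_le _ _).trans (add_le_add hc1 hc2)) hc3)) hc4))
    hc5)) ?_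
  exact le_of_eq (by ring)

/-- If `α` satisfies Chen's relation with a path `γ` of vanishing `2`-variation and is itself of
vanishing `1`-variation, then it is the limit of the areas of the interpolations of `γ`. -/
theorem IsChen.tendsto_pVar_areaOf_interp [CompleteSpace W] (hB : ∀ v, B v v = 0) (hT : 0 < T)
    (hγ : IsVanishingVarPath 2 T γ) (hα : IsChen B T γ α)
    (hα' : ∀ ε > 0, ∃ δ > 0, control 1 δ α 0 T ≤ ε) :
    Tendsto (fun D : Partition 0 T =>
      pVar 1 T (fun s t => areaOf B (D.interp γ) s t - α s t)) (meshToZero 0 T) (𝓝 0) := by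
  refine ENNReal.tendsto_nhds_zero.2 fun ε hε => ?_
  have hε3 : ε / 3 ≠ 0 := (ENNReal.div_pos hε.ne' (by norm_num)).ne'
  have hB' : (10 : ℝ≥0∞) * ‖B‖ₑ ≠ ∞ := ENNReal.mul_ne_top (by norm_num) enorm_ne_top
  -- The weight `l = η⁻¹` in Young's inequality makes the `2`-variation of `γ` contribute at most
  -- `ε / 3`; for this `l`, a small mesh makes the short increments contribute as little.
  obtain ⟨η, hη, hηlt⟩ := ENNReal.exists_nnreal_pos_mul_lt
    (ENNReal.mul_ne_top hB' hγ.control_two_lt_top.ne) hε3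
  have hη0 : (η : ℝ≥0∞) ≠ 0 := by exact_mod_cast hη.ne'
  set l : ℝ≥0∞ := (η : ℝ≥0∞)⁻¹ with hl
  have hl0 : l ≠ 0 := ENNReal.inv_ne_zero.2 ENNReal.coe_ne_top
  have hl1 : l ≠ ∞ := ENNReal.inv_ne_top.2 hη0
  have hlinv : l⁻¹ = η := inv_inv _
  obtain ⟨κ, hκ, hκlt⟩ := ENNReal.exists_nnreal_pos_mul_lt (ENNReal.mul_ne_top hB' hl1) hε3
  obtain ⟨δ₁, hδ₁, h₁⟩ := hα' (ε / 3) (pos_iff_ne_zero.2 hε3)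
  obtain ⟨δ₂, hδ₂, h₂⟩ := (tendsto_omegaVar_iff two_pos).1 hγ.2 κ (by exact_mod_cast hκ)
  set δ := min (min δ₁ δ₂) T
  have hδ : 0 < δ := lt_min (lt_min hδ₁ hδ₂) hT
  have hδ₁' : δ ≤ δ₁ := (min_le_left _ _).trans (min_le_left _ _)
  have hδ₂' : δ ≤ δ₂ := (min_le_left _ _).trans (min_le_right _ _)
  refine eventually_meshToZero.2 ⟨δ, hδ, fun D hD => ?_⟩
  have hg := (control_mono_mesh 2 hδ₂' (increments γ) 0 T).trans h₂
  have hhs := D.isSuperadditive_interpControl γ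
  have hw : IsSuperadditive fun s t => control 1 δ α s t +
      5 * ‖B‖ₑ * (l * (control 2 δ (increments γ) s t + D.interpControl γ s t) +
        l⁻¹ * (control 2 T (increments γ) s t + D.interpControl γ s t)) :=
    (isSuperadditive_control 1 hδ α).add
      (((((isSuperadditive_control 2 hδ _).add hhs).const_mul l).add
        (((isSuperadditive_control 2 hT _).add hhs).const_mul l⁻¹)).const_mul _)
  rw [pVar_eq, div_one, ENNReal.rpow_one]
  refine (control_le_of_forall_le hw fun s t hs hst ht _ => ?_).trans ?_
  · rw [ENNReal.rpow_one, enorm_sub_rev]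
    exact hα.enorm_sub_areaOf_interp_le hB hT D hδ hD hl0 hl1 hs hst ht
  · calc _ ≤ ε / 3 + 5 * ‖B‖ₑ * (l * (κ + κ) + l⁻¹ * (control 2 T (increments γ) 0 T +
            control 2 T (increments γ) 0 T)) := by
          gcongr
          · exact (control_mono_mesh 1 hδ₁' α 0 T).trans h₁
          · exact (D.interpControl_le γ hD 0 T).trans hg
          · exact D.interpControl_le γ (hD.trans (min_le_right _ _)) 0 T
      _ = ε / 3 + κ * (10 * ‖B‖ₑ * l) +
            η * (10 * ‖B‖ₑ * control 2 T (increments γ) 0 T) := by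
          rw [hlinv]
          ring
      _ ≤ ε / 3 + ε / 3 + ε / 3 := by gcongr
      _ = ε := ENNReal.add_thirds ε

end Convergence

/-! ### Chen's relation and Riemann–Stieltjes integrals -/

section Integral

variable {V W : Type*} [NormedAddCommGroup V] [NormedSpace ℝ V] [NormedAddCommGroup W]
  [NormedSpace ℝ W] {B : V →L[ℝ] V →L[ℝ] W} {T : ℝ} {γ : ℝ → V} {α : ℝ → ℝ → W}

theorem IsChen.eq_sum (hα : IsChen B T γ α) {s t : ℝ} (hs : 0 ≤ s) (ht : t ≤ T)
    (D : Partition s t) : α s t = ∑ j ∈ Finset.range D.n,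
      (α (D.pt j) (D.pt (j + 1)) +
        (1 / 2 : ℝ) • B (γ (D.pt j) - γ s) (γ (D.pt (j + 1)) - γ (D.pt j))) := by
  have key : ∀ m ≤ D.n, α s (D.pt m) = ∑ j ∈ Finset.range m,
      (α (D.pt j) (D.pt (j + 1)) +
        (1 / 2 : ℝ) • B (γ (D.pt j) - γ s) (γ (D.pt (j + 1)) - γ (D.pt j))) := by
    intro m hm
    induction m with
    | zero => rw [D.pt_zero, hα.diag hs (D.le.trans ht), Finset.sum_range_zero]
    | succ m ih =>
      rw [Finset.sum_range_succ, ← ih (by omega), hα s (D.pt m) (D.pt (m + 1)) hs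
        (D.left_le_pt (by omega)) (D.lt_succ m (by omega)).le ((D.pt_le_right hm).trans ht),
        add_assoc]
  have h := key D.n le_rfl
  rwa [D.pt_last] at h

/-- A function `α` of vanishing `1`-variation that satisfies Chen's relation with `γ` is given by
Riemann–Stieltjes integrals: a Riemann sum differs from `2 α(s, t)` by a sum over the cells of `α`
and of products of two increments of `γ` inside a cell. -/
theorem IsChen.hasRSIntegral (hα : IsChen B T γ α) (hγ : IsVanishingVarPath 2 T γ)
    (hα' : ∀ ε > 0, ∃ δ > 0, control 1 δ α 0 T ≤ ε) {s t : ℝ} (hs : 0 ≤ s) (hst : s ≤ t)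
    (ht : t ≤ T) :
    HasRSIntegral (fun v w => B v w) (fun u => γ u - γ s) γ s t ((2 : ℝ) • α s t) := by
  refine EMetric.tendsto_nhds.2 fun ε hε => ?_
  obtain ⟨η, hη, hηlt⟩ := ENNReal.exists_nnreal_pos_mul_lt
    (ENNReal.add_ne_top.2 ⟨enorm_ne_top (x := B), ENNReal.ofNat_ne_top (n := 2)⟩) hε.ne'
  obtain ⟨δ₁, hδ₁, h₁⟩ := hα' η (by exact_mod_cast hη)
  obtain ⟨δ₂, hδ₂, h₂⟩ := (tendsto_omegaVar_iff two_pos).1 hγ.2 η (by exact_mod_cast hη)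
  set δ := min δ₁ δ₂
  have hδ : 0 < δ := lt_min hδ₁ hδ₂
  have hg : control 2 δ (increments γ) s t ≤ η :=
    ((isSuperadditive_control 2 hδ _).mono hs hst ht).trans
      ((control_mono_mesh 2 (min_le_right _ _) _ 0 T).trans h₂)
  have ha : control 1 δ α s t ≤ η :=
    ((isSuperadditive_control 1 hδ _).mono hs hst ht).trans
      ((control_mono_mesh 1 (min_le_left _ _) _ 0 T).trans h₁)
  refine eventually_taggedMeshToZero.2 ⟨δ, hδ, fun D hD => ?_⟩
  rw [edist_eq_enorm_sub]
  have hdiff : rsSum (fun v w => B v w) (fun u => γ u - γ s) γ D - (2 : ℝ) • α s t =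
      ∑ j ∈ Finset.range D.n, (B (γ (D.tag j) - γ (D.pt j)) (γ (D.pt (j + 1)) - γ (D.pt j)) -
        (2 : ℝ) • α (D.pt j) (D.pt (j + 1))) := by
    rw [hα.eq_sum hs ht D.toPartition, Finset.smul_sum, rsSum, ← Finset.sum_sub_distrib]
    refine Finset.sum_congr rfl fun j _ => ?_
    simp only [smul_add, smul_smul, map_sub, sub_apply]
    module
  rw [hdiff]
  have hw := ((isSuperadditive_control 2 hδ (increments γ)).const_mul ‖B‖ₑ).add
    ((isSuperadditive_control 1 hδ α).const_mul 2)
  calc _ ≤ ∑ j ∈ Finset.range D.n, (‖B‖ₑ * control 2 δ (increments γ) (D.pt j) (D.pt (j + 1)) +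
          2 * control 1 δ α (D.pt j) (D.pt (j + 1))) := by
        refine (enorm_sum_le _ _).trans (Finset.sum_le_sum fun j hj => ?_)
        have hj := Finset.mem_range.1 hj
        have h1 := D.lt_succ j hj
        have h2 := D.tag_mem j hj
        have h3 := (D.step_le_mesh hj).trans hD
        refine enorm_sub_le.trans (add_le_add ((enorm_apply_apply_le B _ _).trans ?_) ?_)
        · gcongr
          have hx := ((enorm_increments_sq_le_control γ h2.1 (by linarith [h2.2])).trans
            ((isSuperadditive_control 2 hδ _).mono le_rfl h2.1 h2.2))
          have hy := enorm_increments_sq_le_control γ h1.le h3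
          rcases le_total ‖γ (D.tag j) - γ (D.pt j)‖ₑ ‖γ (D.pt (j + 1)) - γ (D.pt j)‖ₑ with h | h
          · refine le_trans ?_ hy
            rw [sq]
            gcongr
          · refine le_trans ?_ hx
            rw [sq]
            gcongr
        · rw [enorm_smul, Real.enorm_of_nonneg zero_le_two, ENNReal.ofReal_ofNat]
          gcongr
          · simpa using enorm_rpow_le_control 1 α h1 h3
    _ ≤ ‖B‖ₑ * control 2 δ (increments γ) s t + 2 * control 1 δ α s t :=
        hw.sum_partition_le D.toPartition
    _ ≤ ‖B‖ₑ * η + 2 * η := by gcongr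
    _ = η * (‖B‖ₑ + 2) := by ring
    _ < ε := hηlt

/-- Chen's relation passes to limits in the rough path norm. -/
theorem isChen_of_tendsto [CompleteSpace W] (hT : 0 < T) {γs : ℕ → ℝ → V}
    (hα0 : ∀ t ∈ Set.Icc 0 T, α t t = 0) (hγs : ∀ n, IsFiniteVarPath 1 T (γs n))
    (h2 : Tendsto (fun n => control 2 T (increments fun t => γ t - γs n t) 0 T) atTop (𝓝 0))
    (h1 : Tendsto (fun n => control 1 T (fun s t => α s t - areaOf B (γs n) s t) 0 T) atTop
      (𝓝 0)) : IsChen B T γ α := by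
  have hA : ∀ s t, 0 ≤ s → s ≤ t → t ≤ T →
      Tendsto (fun n => areaOf B (γs n) s t) atTop (𝓝 (α s t)) := by
    intro s t hs hst ht
    rcases hst.eq_or_lt with rfl | hst
    · rw [hα0 s ⟨hs, ht⟩]
      refine tendsto_const_nhds.congr fun n => ?_
      exact (((hγs n).isChen_area hT).diag hs ht).symm
    · rw [tendsto_iff_edist_tendsto_0]
      refine tendsto_of_tendsto_of_tendsto_of_le_of_le tendsto_const_nhds h1
        (fun _ => zero_le) fun n => ?_
      dsimp only
      rw [edist_comm, edist_eq_enorm_sub]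
      refine le_trans ?_ ((isSuperadditive_control 1 hT _).mono hs hst.le ht)
      simpa using enorm_rpow_le_control 1 (fun s t => α s t - areaOf B (γs n) s t) hst
        (show t - s ≤ T by linarith)
  have hinc : ∀ s t, 0 ≤ s → s ≤ t → t ≤ T →
      Tendsto (fun n => γs n t - γs n s) atTop (𝓝 (γ t - γ s)) := by
    intro s t hs hst ht
    rw [tendsto_iff_edist_tendsto_0]
    have h2' := (ENNReal.continuous_rpow_const (y := 1 / 2)).tendsto 0 |>.comp h2
    rw [ENNReal.zero_rpow_of_pos (by norm_num)] at h2'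
    refine tendsto_of_tendsto_of_tendsto_of_le_of_le tendsto_const_nhds h2'
      (fun _ => zero_le) fun n => ?_
    dsimp only [Function.comp]
    rw [edist_comm, edist_eq_enorm_sub, sub_sub_sub_comm]
    have h := (enorm_increments_sq_le_control (fun t => γ t - γs n t) hst
      (show t - s ≤ T by linarith)).trans ((isSuperadditive_control 2 hT _).mono hs hst ht)
    rw [← ENNReal.rpow_two] at h
    have h' := ENNReal.rpow_le_rpow h (show (0 : ℝ) ≤ 1 / 2 by norm_num)
    rw [← ENNReal.rpow_mul] at h'
    norm_num at h' ⊢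
    exact h'
  intro s t u hs hst htu hu
  refine tendsto_nhds_unique (hA s u hs (hst.trans htu) hu) ?_
  have hB : Tendsto (fun n => B (γs n t - γs n s) (γs n u - γs n t)) atTop
      (𝓝 (B (γ t - γ s) (γ u - γ t))) :=
    (B.isBoundedBilinearMap.continuous.tendsto (γ t - γ s, γ u - γ t)).comp
      ((hinc s t hs hst (htu.trans hu)).prodMk_nhds (hinc t u (hs.trans hst) htu hu))
  refine (((hA s t hs hst (htu.trans hu)).add (hA t u (hs.trans hst) htu hu)).add
    (hB.const_smul (1 / 2 : ℝ))).congr fun n => ?_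
  exact ((hγs n).isChen_area hT s t u hs hst htu hu).symm

/-- Limits in `1`-variation of areas of continuous paths of bounded variation are of vanishing
`1`-variation. -/
theorem exists_control_le_of_tendsto [CompleteSpace W] (hT : 0 < T) {γs : ℕ → ℝ → V}
    (hγs : ∀ n, IsFiniteVarPath 1 T (γs n))
    (h1 : Tendsto (fun n => control 1 T (fun s t => α s t - areaOf B (γs n) s t) 0 T) atTop
      (𝓝 0)) {ε : ℝ≥0∞} (hε : 0 < ε) : ∃ δ > 0, control 1 δ α 0 T ≤ ε := by
  have hε2 : 0 < ε / 2 := ENNReal.half_pos hε.ne'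
  obtain ⟨n, hn⟩ := (ENNReal.tendsto_nhds_zero.1 h1 (ε / 2) hε2).exists
  obtain ⟨δ, hδ, h⟩ := (hγs n).exists_control_area_le (B := B) hT hε2
  refine ⟨min δ T, lt_min hδ hT, ?_⟩
  calc control 1 (min δ T) α 0 T
      ≤ control 1 (min δ T) (fun s t => α s t - areaOf B (γs n) s t) 0 T +
          control 1 (min δ T) (areaOf B (γs n)) 0 T :=
        control_one_add_le fun s t _ _ _ => by
          simpa using enorm_add_le (α s t - areaOf B (γs n) s t) (areaOf B (γs n) s t)
    _ ≤ ε / 2 + ε / 2 := add_le_add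
        ((control_mono_mesh 1 (min_le_right _ _) _ 0 T).trans hn)
        ((control_mono_mesh 1 (min_le_left _ _) _ 0 T).trans h)
    _ = ε := ENNReal.add_halves ε

end Integral

/-! ### Geometric rough paths -/

section Geometric

variable {V : Type*} [NormedAddCommGroup V] [NormedSpace ℝ V] {N : TensorNorm V} {T : ℝ}
  {γ : ℝ → V} {α : ℝ → ℝ → lieSquare N}

theorem bracketL_self (v : V) : bracketL N v v = 0 := by
  refine Subtype.ext ?_
  change ((algBracket N v v : AlgTensor N) : BanachTensor N) = 0
  rw [← UniformSpace.Completion.coe_zero]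
  congr 1
  exact sub_self _

theorem roughNorm_eq (γ : ℝ → V) (α : ℝ → ℝ → lieSquare N) :
    roughNorm N T γ α =
      (control 2 T (increments γ) 0 T + control 1 T α 0 T) ^ (1 / 2 : ℝ) := by
  rw [roughNorm, pVar_eq, pVar_eq, ← ENNReal.rpow_mul]
  norm_num

theorem tendsto_roughNorm_iff {ι : Type*} {l : Filter ι} {γs : ι → ℝ → V}
    {αs : ι → ℝ → ℝ → lieSquare N} :
    Tendsto (fun i => roughNorm N T (γs i) (αs i)) l (𝓝 0) ↔
      Tendsto (fun i => control 2 T (increments (γs i)) 0 T) l (𝓝 0) ∧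
        Tendsto (fun i => control 1 T (αs i) 0 T) l (𝓝 0) := by
  simp only [roughNorm_eq]
  constructor
  · intro h
    have h' := ((ENNReal.continuous_rpow_const (y := 2)).tendsto 0).comp h
    rw [ENNReal.zero_rpow_of_pos two_pos] at h'
    have h'' : Tendsto (fun i => control 2 T (increments (γs i)) 0 T + control 1 T (αs i) 0 T) l
        (𝓝 0) := h'.congr fun i => by
      rw [Function.comp, ← ENNReal.rpow_mul]
      norm_num
    exact ⟨tendsto_of_tendsto_of_tendsto_of_le_of_le tendsto_const_nhds h''
      (fun _ => zero_le) fun _ => le_self_add,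
      tendsto_of_tendsto_of_tendsto_of_le_of_le tendsto_const_nhds h''
      (fun _ => zero_le) fun _ => le_add_self⟩
  · rintro ⟨h2, h1⟩
    have h := ((ENNReal.continuous_rpow_const (y := 1 / 2)).tendsto (0 + 0)).comp (h2.add h1)
    rw [add_zero, ENNReal.zero_rpow_of_pos (by norm_num)] at h
    exact h

theorem IsGeometricRoughPath.isChen (hT : 0 < T) (h : IsGeometricRoughPath N T γ α) :
    IsChen (bracketL N) T γ α := by
  obtain ⟨-, hα, γs, hγs, hlim⟩ := h
  obtain ⟨h2, h1⟩ := tendsto_roughNorm_iff.1 hlim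
  exact isChen_of_tendsto hT hα.2 hγs h2 h1

theorem IsGeometricRoughPath.exists_control_le (hT : 0 < T) (h : IsGeometricRoughPath N T γ α)
    {ε : ℝ≥0∞} (hε : ε > 0) : ∃ δ > 0, control 1 δ α 0 T ≤ ε := by
  obtain ⟨-, -, γs, hγs, hlim⟩ := h
  exact exists_control_le_of_tendsto (B := bracketL N) hT hγs (tendsto_roughNorm_iff.1 hlim).2 hε

theorem IsGeometricRoughPath.interpAreaTendsto (hT : 0 < T) (hγ : IsVanishingVarPath 2 T γ)
    (h : IsGeometricRoughPath N T γ α) : InterpAreaTendsto N T γ α :=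
  (IsChen.tendsto_pVar_areaOf_interp bracketL_self hT hγ (h.isChen hT) fun _ hε =>
    h.exists_control_le hT hε).congr fun _ => rfl

/-- If the areas of the interpolations converge, then these interpolations themselves exhibit the
limit as a geometric rough path over `γ`. -/
theorem InterpAreaTendsto.isGeometricRoughPath (hT : 0 < T) (hγ : IsVanishingVarPath 2 T γ)
    (hα : IsTriangleFun T α) (h : InterpAreaTendsto N T γ α) : IsGeometricRoughPath N T γ α := by
  have hD := tendsto_uniform_meshToZero hT
  refine ⟨hγ.1, hα, fun n => (Partition.uniform hT n).interp γ,
    fun n => Partition.isFiniteVarPath_interp _ γ, tendsto_roughNorm_iff.2 ⟨?_, ?_⟩⟩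
  · have h2 : Tendsto (fun D : Partition 0 T =>
        control 2 T (increments fun t => γ t - D.interp γ t) 0 T) (meshToZero 0 T) (𝓝 0) := by
      refine ENNReal.tendsto_nhds_zero.2 fun ε hε => ?_
      obtain ⟨δ, hδ, hle⟩ := (tendsto_omegaVar_iff two_pos).1 hγ.2 (ε / 8)
        (ENNReal.div_pos hε.ne' (by norm_num))
      refine eventually_meshToZero.2 ⟨δ, hδ, fun D hD => ?_⟩
      refine (D.control_sub_interp_le hT γ hδ hD).trans ?_
      calc 8 * control 2 δ (increments γ) 0 T ≤ 8 * (ε / 8) := by gcongr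
        _ = ε := ENNReal.mul_div_cancel (by norm_num) (by norm_num)
    exact h2.comp hD
  · refine (Tendsto.comp h hD).congr fun n => ?_
    rw [Function.comp, pVar_eq, div_one, ENNReal.rpow_one]
    simp only [control, varSum, enorm_sub_rev]

end Geometric

end RoughArea

end

theorem mainTheorem2 {V : Type*} [NormedAddCommGroup V] [NormedSpace ℝ V] [CompleteSpace V]
    (N : RoughArea.TensorNorm V) (T : ℝ) (hT : 0 < T) (γ : ℝ → V)
    (hγ : RoughArea.IsVanishingVarPath 2 T γ) :
    (RoughArea.IsEnhancible N T γ ↔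
      ∃ α : ℝ → ℝ → RoughArea.lieSquare N,
        RoughArea.IsTriangleFun T α ∧ RoughArea.InterpAreaTendsto N T γ α) ∧
    (∀ α : ℝ → ℝ → RoughArea.lieSquare N, RoughArea.IsGeometricRoughPath N T γ α →
      RoughArea.InterpAreaTendsto N T γ α ∧
      ∀ s t : ℝ, 0 ≤ s → s ≤ t → t ≤ T →
        ∃ I : RoughArea.lieSquare N,
          RoughArea.HasRSIntegral (RoughArea.bracket N) (fun u => γ u - γ s) γ s t I ∧
          α s t = (1 / 2 : ℝ) • I) := by
  refine ⟨⟨?_, ?_⟩, fun α hα => ⟨hα.interpAreaTendsto hT hγ, fun s t hs hst ht => ?_⟩⟩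
  · rintro ⟨-, α, hα, hgeo⟩
    exact ⟨α, hα.1, hgeo.interpAreaTendsto hT hγ⟩
  · rintro ⟨α, hα, hlim⟩
    have hgeo := hlim.isGeometricRoughPath hT hγ hα
    exact ⟨hγ, α, ⟨hα, (RoughArea.tendsto_omegaVar_iff one_pos).2 fun ε hε =>
      hgeo.exists_control_le hT hε⟩, hgeo⟩
  · refine ⟨(2 : ℝ) • α s t, (hα.isChen hT).hasRSIntegral hγ
      (fun ε hε => hα.exists_control_le hT hε) hs hst ht, ?_⟩
    rw [smul_smul]
    norm_num
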